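/- **Setting.** Let $l>2$ be an integer, $q\in\mathbb C$ a primitive $l$-th root of unity, and $q^{1/2}$ a fixed square root of $q$. Put $q'=-q$ and $\eta=(q^{1/2}+q^{-1/2})(q-q^{-1})$. Let $L=l$ if $l$ is even and $L=2l$ if $l$ is odd; let $l'=L/2$ if $l$ is twice an odd integer and $l'=L$ otherwise. Let $\mathcal U=\mathcal U_q(osp(1|2))$ be the unital associative $\mathbb C$-algebra with generators $e,f,k,k^{-1}$ and relations $$kek^{-1}=qe,\quad kfk^{-1}=q^{-1}f,\quad ef+fe=\frac{k-k^{-1}}{q-q^{-1}},\quad kk^{-1}=k^{-1}k=1 .$$ Modules are ungraded. On a space with basis $|m\rangle$ put $Q|m\rangle=q^{-m}|m\rangle$, $U|m\rangle=(-1)^m|m\rangle$, $P|m\rangle=|m+1\rangle$. For $\lambda,\phi,\epsilon\in\mathbb C^*$ and $\sigma\in\mathbb C$ write $W=q^{1/2}\lambda Q-q^{-1/2}\lambda^{-1}Q^{-1}-\sigma U$. * $M_+(\lambda,\phi,\sigma)$ has basis $|0\rangle,\dots,|L-1\rangle$ with $|L\rangle=|0\rangle$, and $k=\lambda Q$, $f=\phi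 P$, $e=\frac1{\eta\phi}P^{-1}W$. * $M_-(\lambda,\epsilon,\sigma)$ has the same basis, and $k=\lambda Q$, $e=\epsilon P^{-1}$, $f=\frac1{\eta\epsilon}WP$. * $M_+(\lambda,\phi)$ and $M_-(\lambda,\epsilon)$ (used for $l$ odd) are given by the same formulas with $\sigma=0$ on the basis $|0\rangle,\dots,|l-1\rangle$ with $|l\rangle=|0\rangle$. * $M_d(\lambda)$ has basis $|0\rangle,\dots,|d-1\rangle$ with $|-1\rangle=|d\rangle=0$, and $k=\lambda Q$, $f=P$, $e=\frac1\eta P'W$, where $P'|m\rangle=|m-1\rangle$ and $\sigma=q^{1/2}\lambda-q^{-1/2}\lambda^{-1}$. It is defined when the quantisation condition $(q'^d-1)(\lambda^2-q'^{d-1})=0$ holds. **Theorem.** (a) A finite-dimensional $\mathcal U$-module is irreducible if and only if it is isomorphic to one of the following: 1. $M_+(\lambda,\phi,\sigma)$, excluding $\sigma=0$ when $l$ is odd (dimension $L$), or, for $l$ odd, $M_+(\lambda,\phi)$ (dimension $l$); 2. $M_-(\lambda,\epsilon,\sigma)$, excluding $\sigma=0$ when $l$ is odd (dimension $L$), or,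 for $l$ odd, $M_-(\lambda,\epsilon)$ (dimension $l$); 3. $M_d(\lambda)$ (dimension $d$) with $1\le d\le l'$, satisfying the quantisation condition and the irreducibility condition $$\prod_{n=1}^{d-1}(q'^n-1)\bigl(q^{1/2-d}\lambda+q^{d-1/2}\lambda^{-1}q'^{-n}\bigr)\neq0 .$$ (b) Say that two modules share the action of an element of $\mathcal U$ if it acts on both as one and the same scalar. * Two modules of the $L$-dimensional types $M_+(\lambda,\phi,\sigma)$, $M_-(\lambda,\epsilon,\sigma)$ (all values of $\sigma$, and any combination of the two types) are isomorphic if and only if they share the action of every central element of $\mathcal U$. * If $l$ is odd, an $L$-dimensional module $M_\pm$ with $\sigma\ne0$ and an $l$-dimensional module $M_\pm$ are never isomorphic and never share the action of all central elements. * If $l$ is odd, two modules of the $l$-dimensional types $M_+(\lambda,\phi)$, $M_-(\lambda,\epsilon)$ are isomorphic if and only if they share the action of every central element and of $f^l$ and $e^l$. They share the action of every central element if and only if they are isomorphic up to parity, that is, one is isomorphic to the other or to the twist of the other by the automorphism $e\mapsto-e$, $f\mapsto-f$, $k\mapsto k$. -/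

import Mathlib

namespace UqOsp

/-! ### The algebra -/

/-- The generators of the quantum superalgebra. -/
inductive Gen
  | e
  | f
  | k
  | kInv

/-- The defining relations of `U_q(osp(1|2))`. -/
inductive Rel (q : ℂ) : FreeAlgebra ℂ Gen → FreeAlgebra ℂ Gen → Prop
  | k_e : Rel q
      (FreeAlgebra.ι ℂ Gen.k * FreeAlgebra.ι ℂ Gen.e * FreeAlgebra.ι ℂ Gen.kInv)
      (q • FreeAlgebra.ι ℂ Gen.e)
  | k_f : Rel q
      (FreeAlgebra.ι ℂ Gen.k * FreeAlgebra.ι ℂ Gen.f * FreeAlgebra.ι ℂ Gen.kInv)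
      (q⁻¹ • FreeAlgebra.ι ℂ Gen.f)
  | e_f : Rel q
      (FreeAlgebra.ι ℂ Gen.e * FreeAlgebra.ι ℂ Gen.f
        + FreeAlgebra.ι ℂ Gen.f * FreeAlgebra.ι ℂ Gen.e)
      ((q - q⁻¹)⁻¹ • (FreeAlgebra.ι ℂ Gen.k - FreeAlgebra.ι ℂ Gen.kInv))
  | k_kInv : Rel q (FreeAlgebra.ι ℂ Gen.k * FreeAlgebra.ι ℂ Gen.kInv) 1
  | kInv_k : Rel q (FreeAlgebra.ι ℂ Gen.kInv * FreeAlgebra.ι ℂ Gen.k) 1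

/-- The unital associative algebra `U_q(osp(1|2))` over `ℂ`. -/
def Uq (q : ℂ) : Type := RingQuot (Rel q)

noncomputable instance (q : ℂ) : Ring (Uq q) := inferInstanceAs (Ring (RingQuot (Rel q)))

noncomputable instance (q : ℂ) : Algebra ℂ (Uq q) :=
  inferInstanceAs (Algebra ℂ (RingQuot (Rel q)))

/-- The class of a generator in `U_q(osp(1|2))`. -/
noncomputable def Uq.gen (q : ℂ) (g : Gen) : Uq q :=
  RingQuot.mkAlgHom ℂ (Rel q) (FreeAlgebra.ι ℂ g)

/-- Operators `E, F, K, K'` that satisfy the defining relations give a representation. -/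
noncomputable def Uq.rep (q : ℂ) {V : Type*} [AddCommGroup V] [Module ℂ V]
    (E F K K' : Module.End ℂ V)
    (hKE : K * E * K' = q • E) (hKF : K * F * K' = q⁻¹ • F)
    (hEF : E * F + F * E = (q - q⁻¹)⁻¹ • (K - K'))
    (hKK' : K * K' = 1) (hK'K : K' * K = 1) : Uq q →ₐ[ℂ] Module.End ℂ V :=
  RingQuot.liftAlgHom ℂ
    ⟨FreeAlgebra.lift ℂ (fun g => match g with
        | Gen.e => E
        | Gen.f => F
        | Gen.k => K
        | Gen.kInv => K'), by
      intro x y h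
      cases h <;> simpa using ‹_›⟩

theorem Uq.rep_gen (q : ℂ) {V : Type*} [AddCommGroup V] [Module ℂ V]
    (E F K K' : Module.End ℂ V) (h₁ h₂ h₃ h₄ h₅) :
    Uq.rep q E F K K' h₁ h₂ h₃ h₄ h₅ (Uq.gen q Gen.e) = E ∧
    Uq.rep q E F K K' h₁ h₂ h₃ h₄ h₅ (Uq.gen q Gen.f) = F ∧
    Uq.rep q E F K K' h₁ h₂ h₃ h₄ h₅ (Uq.gen q Gen.k) = K ∧
    Uq.rep q E F K K' h₁ h₂ h₃ h₄ h₅ (Uq.gen q Gen.kInv) = K' := by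
  refine ⟨?_, ?_, ?_, ?_⟩ <;>
    exact (RingQuot.liftAlgHom_mkAlgHom_apply _ _ _ _).trans (by simp)

/-- The space of a representation, regarded as a module over the algebra. -/
def AsModule {q : ℂ} {V : Type*} [AddCommGroup V] [Module ℂ V]
    (_ρ : Uq q →ₐ[ℂ] Module.End ℂ V) : Type _ := V

section AsModule

variable {q : ℂ} {V : Type*} [AddCommGroup V] [Module ℂ V] (ρ : Uq q →ₐ[ℂ] Module.End ℂ V)

instance : AddCommGroup (AsModule ρ) := inferInstanceAs (AddCommGroup V)

instance : Module ℂ (AsModule ρ) := inferInstanceAs (Module ℂ V)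

noncomputable instance : Module (Uq q) (AsModule ρ) :=
  Module.compHom V (ρ : Uq q →+* Module.End ℂ V)

theorem AsModule.smul_def (u : Uq q) (v : AsModule ρ) : u • v = (ρ u : V →ₗ[ℂ] V) v := rfl

instance : IsScalarTower ℂ (Uq q) (AsModule ρ) where
  smul_assoc c u v := by
    have h : ρ (c • u) = c • ρ u := map_smul ρ c u
    change (ρ (c • u) : V →ₗ[ℂ] V) v = c • (ρ u : V →ₗ[ℂ] V) v
    rw [h]
    rfl

end AsModule

/-! ### The root of unity -/

/-- An integer `l > 2`, a primitive `l`-th root of unity `q` and a fixed square root `s` of `q`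
(so `s` is what is usually written `q^{1/2}`). -/
structure RootDatum where
  l : ℕ
  two_lt_l : 2 < l
  q : ℂ
  isPrimitiveRoot : IsPrimitiveRoot q l
  s : ℂ
  s_sq : s ^ 2 = q

namespace RootDatum

variable (D : RootDatum)

/-- The smallest even multiple of `l`. -/
def L : ℕ := if Even D.l then D.l else 2 * D.l

/-- `l'` is `L / 2` if `l` is twice an odd integer, and `L` otherwise. -/
def l' : ℕ := if D.l % 4 = 2 then D.L / 2 else D.L

/-- `q' = -q`. -/
def q' : ℂ := -D.q

/-- `η = (q^{1/2} + q^{-1/2}) (q - q⁻¹)`. -/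
noncomputable def η : ℂ := (D.s + D.s⁻¹) * (D.q - D.q⁻¹)

theorem q_ne_zero : D.q ≠ 0 :=
  D.isPrimitiveRoot.ne_zero (by have := D.two_lt_l; omega)

theorem s_ne_zero : D.s ≠ 0 := by
  intro h
  apply D.q_ne_zero
  rw [← D.s_sq, h]
  norm_num

theorem q_sq_ne_one : D.q ^ 2 ≠ 1 :=
  D.isPrimitiveRoot.pow_ne_one_of_pos_of_lt (by norm_num) D.two_lt_l

theorem s_add_ne_zero : D.s + D.s⁻¹ ≠ 0 := by
  intro h
  apply D.q_sq_ne_one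
  have hs := D.s_ne_zero
  field_simp at h
  have h2 : D.q = -1 := by rw [← D.s_sq]; linear_combination h
  rw [h2]
  norm_num

theorem q_sub_ne_zero : D.q - D.q⁻¹ ≠ 0 := by
  intro h
  apply D.q_sq_ne_one
  have hq := D.q_ne_zero
  field_simp at h
  linear_combination h

theorem η_ne_zero : D.η ≠ 0 := mul_ne_zero D.s_add_ne_zero D.q_sub_ne_zero

theorem q_pow_L : D.q ^ D.L = 1 := by
  unfold L
  split_ifs
  · exact D.isPrimitiveRoot.pow_eq_one
  · rw [mul_comm, pow_mul, D.isPrimitiveRoot.pow_eq_one, one_pow]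

theorem even_L : Even D.L := by
  unfold L
  split_ifs with h
  · exact h
  · exact even_two_mul _

instance : NeZero D.l := ⟨by have := D.two_lt_l; omega⟩

instance : NeZero D.L := ⟨by
  have := D.two_lt_l
  unfold L
  split_ifs <;> omega⟩

end RootDatum

/-! ### Operators on spaces with a basis of kets -/

/-- The basis vector `|m⟩`. -/
noncomputable def ket {ι : Type*} (m : ι) : ι →₀ ℂ := Finsupp.single m 1

/-- The operator with `|m⟩ ↦ g m`. -/
noncomputable def onKets {ι : Type*} (g : ι → ι →₀ ℂ) : Module.End ℂ (ι →₀ ℂ) :=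
  Finsupp.linearCombination ℂ g

@[simp] theorem onKets_ket {ι : Type*} (g : ι → ι →₀ ℂ) (m : ι) : onKets g (ket m) = g m := by
  simp [onKets, ket]

theorem ext_ket {ι : Type*} {A B : Module.End ℂ (ι →₀ ℂ)} (h : ∀ m, A (ket m) = B (ket m)) :
    A = B :=
  Finsupp.lhom_ext' fun m => LinearMap.ext_ring (h m)

/-! ### Periodic modules -/

/-- `Q|m⟩ = q^{-m}|m⟩` for `m` modulo `N` (used with `q ^ N = 1`). The inverse of `Q` is
`cycQ q⁻¹ N`. -/
noncomputable def cycQ (q : ℂ) (N : ℕ) : Module.End ℂ (ZMod N →₀ ℂ) :=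
  onKets fun m => (q⁻¹) ^ m.val • ket m

/-- `U|m⟩ = (-1)^m|m⟩` for `m` modulo `N` (used with `N` even, or multiplied by zero). -/
noncomputable def cycU (N : ℕ) : Module.End ℂ (ZMod N →₀ ℂ) :=
  onKets fun m => (-1 : ℂ) ^ m.val • ket m

/-- `P|m⟩ = |m+1⟩` for `m` modulo `N`. -/
noncomputable def cycP (N : ℕ) : Module.End ℂ (ZMod N →₀ ℂ) := onKets fun m => ket (m + 1)

/-- `P⁻¹|m⟩ = |m-1⟩` for `m` modulo `N`. -/
noncomputable def cycPInv (N : ℕ) : Module.End ℂ (ZMod N →₀ ℂ) := onKets fun m => ket (m - 1)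

theorem cyc_pow_succ {z : ℂ} {N : ℕ} [NeZero N] (hz : z ^ N = 1) (m : ZMod N) :
    z ^ (m + 1).val = z * z ^ m.val := by
  rw [ZMod.val_add, ← pow_eq_pow_mod _ hz, pow_add, mul_comm]
  congr 1
  rw [ZMod.val_one_eq_one_mod, ← pow_eq_pow_mod _ hz, pow_one]

namespace RootDatum

variable (D : RootDatum)

/-- `q^{1/2} λ Q - q^{-1/2} λ⁻¹ Q⁻¹ - σ U` on the space with basis `|m⟩`, `m` modulo `N`. -/
noncomputable def cycW (N : ℕ) (lam : ℂˣ) (σ : ℂ) : Module.End ℂ (ZMod N →₀ ℂ) :=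
  (D.s * lam) • cycQ D.q N - (D.s⁻¹ * (lam : ℂ)⁻¹) • cycQ D.q⁻¹ N - σ • cycU N

/-- The eigenvalue of `cycW` on `|m⟩`. -/
noncomputable def cycw (N : ℕ) (lam : ℂˣ) (σ : ℂ) (m : ZMod N) : ℂ :=
  D.s * lam * (D.q ^ m.val)⁻¹ - D.s⁻¹ * (lam : ℂ)⁻¹ * D.q ^ m.val - σ * (-1) ^ m.val

theorem cycW_ket (N : ℕ) (lam : ℂˣ) (σ : ℂ) (m : ZMod N) :
    D.cycW N lam σ (ket m) = D.cycw N lam σ m • ket m := by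
  simp [cycW, cycw, cycQ, cycU, sub_smul, mul_smul]

theorem cycw_add {N : ℕ} [NeZero N] (hN : D.q ^ N = 1) (lam : ℂˣ) (σ : ℂ)
    (hσ : σ = 0 ∨ Even N) (m : ZMod N) :
    D.cycw N lam σ (m + 1) + D.cycw N lam σ m =
      (D.s + D.s⁻¹) * (lam * (D.q ^ m.val)⁻¹ - (lam : ℂ)⁻¹ * D.q ^ m.val) := by
  have hU : σ * (-1) ^ (m + 1).val = -(σ * (-1) ^ m.val) := by
    rcases hσ with rfl | h
    · simp
    · rw [cyc_pow_succ h.neg_one_pow]; ring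
  have hs := D.s_ne_zero
  have hq := D.q_ne_zero
  have hl : (lam : ℂ) ≠ 0 := lam.ne_zero
  have hm : D.q ^ m.val ≠ 0 := pow_ne_zero _ hq
  unfold cycw
  rw [hU, cyc_pow_succ hN]
  generalize D.q ^ m.val = x at hm ⊢
  rw [← D.s_sq]
  field_simp
  ring

/-- The representation `k = λ Q`, `f = φ P`, `e = (η φ)⁻¹ P⁻¹ (q^{1/2} λ Q - q^{-1/2} λ⁻¹ Q⁻¹ - σ U)`
on the space with basis `|m⟩`, `m` modulo `N`. -/
noncomputable def cycPlus (N : ℕ) [NeZero N] (hN : D.q ^ N = 1) (lam φ : ℂˣ) (σ : ℂ)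
    (hσ : σ = 0 ∨ Even N) : Uq D.q →ₐ[ℂ] Module.End ℂ (ZMod N →₀ ℂ) :=
  Uq.rep D.q
    ((D.η * φ)⁻¹ • (cycPInv N * D.cycW N lam σ))
    ((φ : ℂ) • cycP N)
    ((lam : ℂ) • cycQ D.q N)
    ((lam : ℂ)⁻¹ • cycQ D.q⁻¹ N)
    (by
      apply ext_ket
      intro m
      obtain ⟨m, rfl⟩ : ∃ n, m = n + 1 := ⟨m - 1, by simp⟩
      have hq := D.q_ne_zero
      have hm : D.q ^ m.val ≠ 0 := pow_ne_zero _ hq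
      simp only [Module.End.mul_apply, LinearMap.smul_apply, map_smul, cycQ, cycPInv, onKets_ket,
        cycW_ket, smul_smul, inv_inv, add_sub_cancel_right, inv_pow, cyc_pow_succ hN]
      congr 1
      field_simp)
    (by
      apply ext_ket
      intro m
      have hq := D.q_ne_zero
      have hm : D.q ^ m.val ≠ 0 := pow_ne_zero _ hq
      simp only [Module.End.mul_apply, LinearMap.smul_apply, map_smul, cycQ, cycP, onKets_ket,
        smul_smul, inv_inv, inv_pow, cyc_pow_succ hN]
      congr 1
      field_simp)
    (by
      apply ext_ket
      intro m
      simp only [Module.End.mul_apply, LinearMap.smul_apply, LinearMap.add_apply,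
        LinearMap.sub_apply, map_smul, cycQ, cycP, cycPInv, onKets_ket,
        cycW_ket, smul_smul, inv_inv, inv_pow, add_sub_cancel_right, sub_add_cancel, ← add_smul,
        ← sub_smul]
      congr 1
      have h := D.cycw_add hN lam σ hσ m
      have h1 := D.s_add_ne_zero
      have h2 := D.q_sub_ne_zero
      have hφ : (φ : ℂ) ≠ 0 := φ.ne_zero
      trans (D.η)⁻¹ * (D.cycw N lam σ (m + 1) + D.cycw N lam σ m)
      · have h3 := D.η_ne_zero
        field_simp
      · rw [h, η]
        generalize D.s + D.s⁻¹ = A at h1 ⊢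
        generalize D.q - D.q⁻¹ = B at h2 ⊢
        rw [mul_inv, mul_comm A⁻¹, mul_assoc, inv_mul_cancel_left₀ h1])
    (by
      apply ext_ket
      intro m
      simp [cycQ, smul_smul, D.q_ne_zero])
    (by
      apply ext_ket
      intro m
      simp [cycQ, smul_smul, D.q_ne_zero])

/-- The representation `k = λ Q`, `e = ε P⁻¹`, `f = (η ε)⁻¹ (q^{1/2} λ Q - q^{-1/2} λ⁻¹ Q⁻¹ - σ U) P`
on the space with basis `|m⟩`, `m` modulo `N`. -/
noncomputable def cycMinus (N : ℕ) [NeZero N] (hN : D.q ^ N = 1) (lam ε : ℂˣ) (σ : ℂ)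
    (hσ : σ = 0 ∨ Even N) : Uq D.q →ₐ[ℂ] Module.End ℂ (ZMod N →₀ ℂ) :=
  Uq.rep D.q
    ((ε : ℂ) • cycPInv N)
    ((D.η * ε)⁻¹ • (D.cycW N lam σ * cycP N))
    ((lam : ℂ) • cycQ D.q N)
    ((lam : ℂ)⁻¹ • cycQ D.q⁻¹ N)
    (by
      apply ext_ket
      intro m
      obtain ⟨m, rfl⟩ : ∃ n, m = n + 1 := ⟨m - 1, by simp⟩
      have hq := D.q_ne_zero
      have hm : D.q ^ m.val ≠ 0 := pow_ne_zero _ hq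
      simp only [Module.End.mul_apply, LinearMap.smul_apply, map_smul, cycQ, cycPInv, onKets_ket,
        smul_smul, inv_inv, add_sub_cancel_right, inv_pow, cyc_pow_succ hN]
      congr 1
      field_simp)
    (by
      apply ext_ket
      intro m
      have hq := D.q_ne_zero
      have hm : D.q ^ m.val ≠ 0 := pow_ne_zero _ hq
      simp only [Module.End.mul_apply, LinearMap.smul_apply, map_smul, cycQ, cycP, onKets_ket,
        cycW_ket, smul_smul, inv_inv, inv_pow, cyc_pow_succ hN]
      congr 1
      field_simp)
    (by
      apply ext_ket
      intro m
      simp only [Module.End.mul_apply, LinearMap.smul_apply, LinearMap.add_apply,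
        LinearMap.sub_apply, map_smul, cycQ, cycP, cycPInv, onKets_ket,
        cycW_ket, smul_smul, inv_inv, inv_pow, add_sub_cancel_right, sub_add_cancel, ← add_smul,
        ← sub_smul]
      congr 1
      have h := D.cycw_add hN lam σ hσ m
      have h1 := D.s_add_ne_zero
      have h2 := D.q_sub_ne_zero
      have hε : (ε : ℂ) ≠ 0 := ε.ne_zero
      trans (D.η)⁻¹ * (D.cycw N lam σ (m + 1) + D.cycw N lam σ m)
      · have h3 := D.η_ne_zero
        field_simp
      · rw [h, η]
        generalize D.s + D.s⁻¹ = A at h1 ⊢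
        generalize D.q - D.q⁻¹ = B at h2 ⊢
        rw [mul_inv, mul_comm A⁻¹, mul_assoc, inv_mul_cancel_left₀ h1])
    (by
      apply ext_ket
      intro m
      simp [cycQ, smul_smul, D.q_ne_zero])
    (by
      apply ext_ket
      intro m
      simp [cycQ, smul_smul, D.q_ne_zero])

/-- The `f`-periodic module `M_+(λ, φ, σ)`, with basis `|m⟩`, `m` modulo `L`. -/
abbrev MPlus (lam φ : ℂˣ) (σ : ℂ) : Type :=
  AsModule (D.cycPlus D.L D.q_pow_L lam φ σ (Or.inr D.even_L))

/-- The `e`-periodic module `M_-(λ, ε, σ)`, with basis `|m⟩`, `m` modulo `L`. -/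
abbrev MMinus (lam ε : ℂˣ) (σ : ℂ) : Type :=
  AsModule (D.cycMinus D.L D.q_pow_L lam ε σ (Or.inr D.even_L))

/-- The module `M_+(λ, φ)`: same formulas with `σ = 0`, with basis `|m⟩`, `m` modulo `l`. -/
abbrev MPlusRed (lam φ : ℂˣ) : Type :=
  AsModule (D.cycPlus D.l D.isPrimitiveRoot.pow_eq_one lam φ 0 (Or.inl rfl))

/-- The module `M_-(λ, ε)`: same formulas with `σ = 0`, with basis `|m⟩`, `m` modulo `l`. -/
abbrev MMinusRed (lam ε : ℂˣ) : Type :=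
  AsModule (D.cycMinus D.l D.isPrimitiveRoot.pow_eq_one lam ε 0 (Or.inl rfl))

end RootDatum

/-! ### Nilpotent modules -/

/-- `Q|m⟩ = q^{-m}|m⟩` for `0 ≤ m < d`. The inverse of `Q` is `nilQ q⁻¹ d`. -/
noncomputable def nilQ (q : ℂ) (d : ℕ) : Module.End ℂ (Fin d →₀ ℂ) :=
  onKets fun m => (q⁻¹) ^ (m : ℕ) • ket m

/-- `U|m⟩ = (-1)^m|m⟩` for `0 ≤ m < d`. -/
noncomputable def nilU (d : ℕ) : Module.End ℂ (Fin d →₀ ℂ) :=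
  onKets fun m => (-1 : ℂ) ^ (m : ℕ) • ket m

/-- `P|m⟩ = |m+1⟩`, where `|d⟩ = 0`. -/
noncomputable def nilP (d : ℕ) : Module.End ℂ (Fin d →₀ ℂ) :=
  onKets fun m => if h : (m : ℕ) + 1 < d then ket ⟨m + 1, h⟩ else 0

/-- `P'|m⟩ = |m-1⟩`, where `|-1⟩ = 0`. -/
noncomputable def nilP' (d : ℕ) : Module.End ℂ (Fin d →₀ ℂ) :=
  onKets fun m => if (m : ℕ) = 0 then 0 else ket ⟨m - 1, lt_of_le_of_lt (Nat.sub_le _ _) m.isLt⟩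

namespace RootDatum

variable (D : RootDatum)

/-- The quantisation condition `(q'^d - 1)(λ² - q'^{d-1}) = 0` (for `d ≥ 1`). -/
def Quantised (d : ℕ) (lam : ℂˣ) : Prop :=
  (D.q' ^ d - 1) * ((lam : ℂ) ^ 2 - D.q' ^ (d - 1)) = 0

/-- The irreducibility condition
`∏_{n=1}^{d-1} (q'^n - 1)(q^{1/2-d} λ + q^{d-1/2} λ⁻¹ q'^{-n}) ≠ 0`. -/
def IrredCond (d : ℕ) (lam : ℂˣ) : Prop :=
  ∏ n ∈ Finset.Icc 1 (d - 1),
    ((D.q' ^ n - 1) *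
      (D.s * (D.q ^ d)⁻¹ * lam + D.q ^ d * D.s⁻¹ * (lam : ℂ)⁻¹ * (D.q' ^ n)⁻¹)) ≠ 0

/-- The scalar `σ = q^{1/2} λ - q^{-1/2} λ⁻¹` of the nilpotent module. -/
noncomputable def nilσ (lam : ℂˣ) : ℂ := D.s * lam - D.s⁻¹ * (lam : ℂ)⁻¹

/-- `q^{1/2} λ Q - q^{-1/2} λ⁻¹ Q⁻¹ - σ U` on the space with basis `|m⟩`, `0 ≤ m < d`. -/
noncomputable def nilW (d : ℕ) (lam : ℂˣ) (σ : ℂ) : Module.End ℂ (Fin d →₀ ℂ) :=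
  (D.s * lam) • nilQ D.q d - (D.s⁻¹ * (lam : ℂ)⁻¹) • nilQ D.q⁻¹ d - σ • nilU d

/-- The eigenvalue of `nilW` on `|m⟩`. -/
noncomputable def nilw (lam : ℂˣ) (σ : ℂ) (m : ℕ) : ℂ :=
  D.s * lam * (D.q ^ m)⁻¹ - D.s⁻¹ * (lam : ℂ)⁻¹ * D.q ^ m - σ * (-1) ^ m

theorem nilW_ket (d : ℕ) (lam : ℂˣ) (σ : ℂ) (m : Fin d) :
    D.nilW d lam σ (ket m) = D.nilw lam σ m • ket m := by
  simp [nilW, nilw, nilQ, nilU, sub_smul, mul_smul]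

theorem nilw_add (lam : ℂˣ) (σ : ℂ) (m : ℕ) :
    D.nilw lam σ (m + 1) + D.nilw lam σ m =
      (D.s + D.s⁻¹) * (lam * (D.q ^ m)⁻¹ - (lam : ℂ)⁻¹ * D.q ^ m) := by
  have hs := D.s_ne_zero
  have hq := D.q_ne_zero
  have hl : (lam : ℂ) ≠ 0 := lam.ne_zero
  have hm : D.q ^ m ≠ 0 := pow_ne_zero _ hq
  unfold nilw
  rw [pow_succ, pow_succ (-1 : ℂ)]
  generalize D.q ^ m = x at hm ⊢
  rw [← D.s_sq]
  field_simp
  ring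

theorem nilw_zero (lam : ℂˣ) : D.nilw lam (D.nilσ lam) 0 = 0 := by
  simp [nilw, nilσ]

theorem nilw_last {d : ℕ} (hd : 1 ≤ d) (lam : ℂˣ) (h : D.Quantised d lam) :
    D.nilw lam (D.nilσ lam) d = 0 := by
  have hs := D.s_ne_zero
  have hq := D.q_ne_zero
  have hl : (lam : ℂ) ≠ 0 := lam.ne_zero
  have hm : D.q ^ d ≠ 0 := pow_ne_zero _ hq
  obtain ⟨n, rfl⟩ : ∃ n, d = n + 1 := ⟨d - 1, by omega⟩
  have hx : D.q ^ n ≠ 0 := pow_ne_zero _ hq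
  unfold Quantised q' at h
  rw [Nat.add_sub_cancel, neg_pow, neg_pow D.q n] at h
  unfold nilw nilσ
  have hu : ((-1 : ℂ) ^ n) * (-1) ^ n = 1 := by rw [← mul_pow]; norm_num
  simp only [pow_succ] at h
  simp only [pow_succ]
  generalize (-1 : ℂ) ^ n = u at hu h ⊢
  generalize D.q ^ n = x at hx h ⊢
  rw [← D.s_sq] at *
  field_simp
  linear_combination (-1 : ℂ) * h + (x ^ 2 * D.s ^ 2) * hu

/-- The representation `k = λ Q`, `f = P`, `e = η⁻¹ P' (q^{1/2} λ Q - q^{-1/2} λ⁻¹ Q⁻¹ - σ U)` with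
`σ = q^{1/2} λ - q^{-1/2} λ⁻¹`, on the space with basis `|m⟩`, `0 ≤ m < d`. -/
noncomputable def nil (d : ℕ) (lam : ℂˣ) (h : D.Quantised d lam) :
    Uq D.q →ₐ[ℂ] Module.End ℂ (Fin d →₀ ℂ) :=
  Uq.rep D.q
    (D.η⁻¹ • (nilP' d * D.nilW d lam (D.nilσ lam)))
    (nilP d)
    ((lam : ℂ) • nilQ D.q d)
    ((lam : ℂ)⁻¹ • nilQ D.q⁻¹ d)
    (by
      apply ext_ket
      rintro ⟨m, hm⟩
      have hq := D.q_ne_zero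
      rcases m with _ | m
      · simp [nilQ, nilP', nilW_ket, smul_smul]
      · have hx : D.q ^ m ≠ 0 := pow_ne_zero _ hq
        simp [nilQ, nilP', nilW_ket, smul_smul, pow_succ]
        congr 1
        field_simp)
    (by
      apply ext_ket
      rintro ⟨m, hm⟩
      have hq := D.q_ne_zero
      have hx : D.q ^ m ≠ 0 := pow_ne_zero _ hq
      by_cases hd : m + 1 < d
      · simp [nilQ, nilP, smul_smul, pow_succ, hd]
        congr 1
        field_simp
      · simp [nilQ, nilP, hd])
    (by
      apply ext_ket
      rintro ⟨m, hm⟩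
      have hadd := D.nilw_add lam (D.nilσ lam) m
      have h1 := D.s_add_ne_zero
      have key : D.η⁻¹ * (D.nilw lam (D.nilσ lam) (m + 1) + D.nilw lam (D.nilσ lam) m) =
          (D.q - D.q⁻¹)⁻¹ * (lam * (D.q ^ m)⁻¹ - (lam : ℂ)⁻¹ * D.q ^ m) := by
        rw [hadd, η]
        generalize D.s + D.s⁻¹ = A at h1 ⊢
        rw [mul_inv, mul_comm A⁻¹, mul_assoc, inv_mul_cancel_left₀ h1]
      have hR : ((D.q - D.q⁻¹)⁻¹ • ((lam : ℂ) • nilQ D.q d - (lam : ℂ)⁻¹ • nilQ D.q⁻¹ d) :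
          Module.End ℂ (Fin d →₀ ℂ)) (ket ⟨m, hm⟩) =
          (D.η⁻¹ * (D.nilw lam (D.nilσ lam) (m + 1) + D.nilw lam (D.nilσ lam) m)) •
            ket ⟨m, hm⟩ := by
        rw [key]
        simp [nilQ, smul_smul, ← sub_smul]
      have hEF : (D.η⁻¹ • (nilP' d * D.nilW d lam (D.nilσ lam)) * nilP d :
          Module.End ℂ (Fin d →₀ ℂ)) (ket ⟨m, hm⟩) =
          (D.η⁻¹ * D.nilw lam (D.nilσ lam) (m + 1)) • ket ⟨m, hm⟩ := by
        by_cases hd : m + 1 < d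
        · simp [nilP, nilP', nilW_ket, smul_smul, hd]
        · have hd' : m + 1 = d := by omega
          rw [hd', D.nilw_last (by omega) lam h]
          simp [nilP, hd]
      have hFE : (nilP d * (D.η⁻¹ • (nilP' d * D.nilW d lam (D.nilσ lam))) :
          Module.End ℂ (Fin d →₀ ℂ)) (ket ⟨m, hm⟩) =
          (D.η⁻¹ * D.nilw lam (D.nilσ lam) m) • ket ⟨m, hm⟩ := by
        rcases m with _ | m
        · simp [nilW_ket, D.nilw_zero]
        · simp [nilP, nilP', nilW_ket, smul_smul, hm]
      rw [hR, LinearMap.add_apply, hEF, hFE, ← add_smul, mul_add])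
    (by
      apply ext_ket
      intro m
      simp [nilQ, smul_smul, D.q_ne_zero])
    (by
      apply ext_ket
      intro m
      simp [nilQ, smul_smul, D.q_ne_zero])

/-- The nilpotent module `M_d(λ)`, with basis `|m⟩`, `0 ≤ m < d`. -/
abbrev MNil (d : ℕ) (lam : ℂˣ) (h : D.Quantised d lam) : Type := AsModule (D.nil d lam h)

end RootDatum

/-! ### The list of modules, up to isomorphism -/

namespace RootDatum

variable (D : RootDatum) (V : Type*) [AddCommGroup V] [Module (Uq D.q) V]

/-- `V` is isomorphic to some `M_+(λ, φ, σ)` or `M_-(λ, ε, σ)` where `σ` satisfies `p`. -/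
def IsPeriodic (p : ℂ → Prop) : Prop :=
  (∃ (lam φ : ℂˣ) (σ : ℂ), p σ ∧ Nonempty (V ≃ₗ[Uq D.q] D.MPlus lam φ σ)) ∨
  (∃ (lam ε : ℂˣ) (σ : ℂ), p σ ∧ Nonempty (V ≃ₗ[Uq D.q] D.MMinus lam ε σ))

/-- `l` is odd and `V` is isomorphic to some `M_+(λ, φ)` or `M_-(λ, ε)`. -/
def IsReducedPeriodic : Prop :=
  Odd D.l ∧
    ((∃ lam φ : ℂˣ, Nonempty (V ≃ₗ[Uq D.q] D.MPlusRed lam φ)) ∨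
     (∃ lam ε : ℂˣ, Nonempty (V ≃ₗ[Uq D.q] D.MMinusRed lam ε)))

/-- `V` is isomorphic to some `M_d(λ)` with `1 ≤ d ≤ l'` that satisfies the quantisation and
irreducibility conditions. -/
def IsNilpotentType : Prop :=
  ∃ (d : ℕ) (lam : ℂˣ) (h : D.Quantised d lam), 1 ≤ d ∧ d ≤ D.l' ∧ D.IrredCond d lam ∧
    Nonempty (V ≃ₗ[Uq D.q] D.MNil d lam h)

end RootDatum

section Compare

variable {q : ℂ} (V W : Type*) [AddCommGroup V] [AddCommGroup W]
  [Module (Uq q) V] [Module (Uq q) W] [Module ℂ V] [Module ℂ W]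

/-- `u` acts on `V` and on `W` as one and the same scalar. -/
def SameScalar (u : Uq q) : Prop := ∃ c : ℂ, (∀ v : V, u • v = c • v) ∧ ∀ w : W, u • w = c • w

/-- Every central element acts on `V` and on `W` as one and the same scalar. -/
def SameCentralAction : Prop := ∀ z ∈ Subalgebra.center ℂ (Uq q), SameScalar V W z

/-- `V` is isomorphic to the twist of `W` by the parity automorphism
`e ↦ -e`, `f ↦ -f`, `k ↦ k`. -/
def ParityIsomorphic : Prop :=
  ∃ T : V ≃ₗ[ℂ] W, ∀ v : V,
    T (Uq.gen q Gen.e • v) = -(Uq.gen q Gen.e • T v) ∧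
    T (Uq.gen q Gen.f • v) = -(Uq.gen q Gen.f • T v) ∧
    T (Uq.gen q Gen.k • v) = Uq.gen q Gen.k • T v

end Compare

end UqOsp

namespace UqOsp

/-! ### Generators and relations -/

section Generators

variable {q : ℂ}

/-! The engine is the element `S`. It commutes with `k` and anticommutes with `e` and `f`, and both
`η f e` and `η e f` are combinations of `k`, `k⁻¹` and `S`. Every nonzero finite-dimensional module
contains a joint eigenvector of `k` and `S`, with eigenvalues `λ`, `σ`. On it `f e` and `e f` act by
scalars, so its orbit under powers of `f` (or of `e`) is a string on which the action is determined
by `(λ, σ)`. The listed modules are the ways in which such a string can close up or stop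
(`exists_hom_cycPlus`, `exists_hom_cycMinus`, `exists_hom_nil`).

Since `L` is even and `q ^ L = 1`, the elements `e ^ L` and `f ^ L` are central, hence scalars on a
simple module. If `f ^ L` is nonzero there is a nonzero map from some `M_+`; if `e ^ L` is nonzero,
from some `M_-`; if both vanish, from some `M_d`. When `l` is odd and `σ = 0`, `S` acts as zero and
already `e ^ l`, `f ^ l` are scalars, which gives the modules of dimension `l`. The source is simple
too, so the map is an isomorphism. The modules `M_±` are simple because the joint weights along the
string are distinct (`separated_L`, `IsLadder.isSimpleModule`). For `M_d` what matters is that `e`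
kills no basis vector except the first, and the irreducibility condition says exactly this
(`irredCond_iff`).

For (b), the scalars of `k ^ l` and of `S ^ 2` (or of `S k ^ (l/2)` when `l` is even) determine `(λ,
σ)` up to a move along the string, and `f ^ L` or `e ^ L` supplies the period, so both modules are
identified with one and the same `M_+` or `M_-`. In dimension `l` the scalar of `f ^ L` fixes that
of `f ^ l` only up to sign, and the parity twist changes this sign. The converses need the centre to
act by scalars. For `σ = 0` and `l` odd this does not come from Schur's lemma but from continuity in
`σ` (`exists_scalar_of_continuous`). It also shows that a module and its twist share the central
action, as both receive nonzero maps from the same `M_±` with `σ = 0` (`exists_common_scalar`). -/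

theorem Uq.adjoin_range_gen (q : ℂ) : Algebra.adjoin ℂ (Set.range (Uq.gen q)) = ⊤ := by
  have h : Set.range (Uq.gen q) = RingQuot.mkAlgHom ℂ (Rel q) '' Set.range (FreeAlgebra.ι ℂ) := by
    rw [← Set.range_comp]; rfl
  rw [h]
  refine (AlgHom.map_adjoin (RingQuot.mkAlgHom ℂ (Rel q)) _).symm.trans ?_
  rw [FreeAlgebra.adjoin_range_ι, Algebra.map_top]
  exact (AlgHom.range_eq_top _).2 (RingQuot.mkAlgHom_surjective ℂ (Rel q))

theorem Uq.induction {p : Uq q → Prop} (algebraMap : ∀ c : ℂ, p (algebraMap ℂ (Uq q) c))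
    (gen : ∀ g, p (Uq.gen q g)) (add : ∀ x y, p x → p y → p (x + y))
    (mul : ∀ x y, p x → p y → p (x * y)) (u : Uq q) : p u := by
  have hu : u ∈ Algebra.adjoin ℂ (Set.range (Uq.gen q)) := by
    rw [Uq.adjoin_range_gen]; trivial
  refine Algebra.adjoin_induction (p := fun x _ => p x) ?_ algebraMap
    (fun x y _ _ => add x y) (fun x y _ _ => mul x y) hu
  rintro _ ⟨g, rfl⟩
  exact gen g

theorem Uq.k_mul_kInv : Uq.gen q Gen.k * Uq.gen q Gen.kInv = 1 := by
  have h := RingQuot.mkAlgHom_rel ℂ (Rel.k_kInv (q := q))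
  rw [map_mul, map_one] at h
  exact h

theorem Uq.kInv_mul_k : Uq.gen q Gen.kInv * Uq.gen q Gen.k = 1 := by
  have h := RingQuot.mkAlgHom_rel ℂ (Rel.kInv_k (q := q))
  rw [map_mul, map_one] at h
  exact h

theorem Uq.k_mul_e : Uq.gen q Gen.k * Uq.gen q Gen.e = q • (Uq.gen q Gen.e * Uq.gen q Gen.k) := by
  have h := RingQuot.mkAlgHom_rel ℂ (Rel.k_e (q := q))
  rw [map_mul, map_mul, map_smul] at h
  have h' : Uq.gen q Gen.k * Uq.gen q Gen.e * Uq.gen q Gen.kInv = q • Uq.gen q Gen.e := h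
  rw [← smul_mul_assoc, ← h', mul_assoc, Uq.kInv_mul_k, mul_one]

theorem Uq.k_mul_f :
    Uq.gen q Gen.k * Uq.gen q Gen.f = q⁻¹ • (Uq.gen q Gen.f * Uq.gen q Gen.k) := by
  have h := RingQuot.mkAlgHom_rel ℂ (Rel.k_f (q := q))
  rw [map_mul, map_mul, map_smul] at h
  have h' : Uq.gen q Gen.k * Uq.gen q Gen.f * Uq.gen q Gen.kInv = q⁻¹ • Uq.gen q Gen.f := h
  rw [← smul_mul_assoc, ← h', mul_assoc, Uq.kInv_mul_k, mul_one]

theorem Uq.e_mul_f :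
    Uq.gen q Gen.e * Uq.gen q Gen.f = (q - q⁻¹)⁻¹ • (Uq.gen q Gen.k - Uq.gen q Gen.kInv) -
      Uq.gen q Gen.f * Uq.gen q Gen.e := by
  have h := RingQuot.mkAlgHom_rel ℂ (Rel.e_f (q := q))
  rw [map_add, map_mul, map_mul, map_smul, map_sub] at h
  exact eq_sub_of_add_eq h

theorem Uq.kInv_mul_of_k_mul {c : ℂ} (hc : c ≠ 0) {x : Uq q}
    (h : Uq.gen q Gen.k * x = c • (x * Uq.gen q Gen.k)) :
    Uq.gen q Gen.kInv * x = c⁻¹ • (x * Uq.gen q Gen.kInv) := by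
  have h1 := congrArg (fun y => c⁻¹ • (Uq.gen q Gen.kInv * y * Uq.gen q Gen.kInv)) h
  rw [← mul_assoc, Uq.kInv_mul_k, one_mul, mul_smul_comm, smul_mul_assoc, smul_smul,
    inv_mul_cancel₀ hc, one_smul, mul_assoc, mul_assoc x, Uq.k_mul_kInv, mul_one] at h1
  exact h1.symm

theorem Uq.mem_center {z : Uq q} (he : Commute (Uq.gen q Gen.e) z)
    (hf : Commute (Uq.gen q Gen.f) z) (hk : Commute (Uq.gen q Gen.k) z) :
    z ∈ Subalgebra.center ℂ (Uq q) := by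
  rw [Subalgebra.mem_center_iff]
  have hkInv : Commute (Uq.gen q Gen.kInv) z := by
    have h := Uq.kInv_mul_of_k_mul (c := 1) one_ne_zero (x := z) (by rw [one_smul]; exact hk)
    rwa [inv_one, one_smul] at h
  intro u
  change Commute u z
  induction u using Uq.induction with
  | algebraMap c => exact Algebra.commute_algebraMap_left c z
  | gen g => cases g <;> assumption
  | add x y hx hy => exact hx.add_left hy
  | mul x y hx hy => exact hx.mul_left hy

end Generators

/-! ### Linearity over the algebra, tested on generators. -/

section Hom

variable {q : ℂ} {V W : Type*} [AddCommGroup V] [AddCommGroup W] [Module ℂ V] [Module ℂ W]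
  [Module (Uq q) V] [Module (Uq q) W] [IsScalarTower ℂ (Uq q) V] [IsScalarTower ℂ (Uq q) W]

/-- A `ℂ`-linear map that commutes with `e`, `f` and `k` is linear over the algebra. -/
def homOfGens (T : V →ₗ[ℂ] W)
    (he : ∀ v, T (Uq.gen q Gen.e • v) = Uq.gen q Gen.e • T v)
    (hf : ∀ v, T (Uq.gen q Gen.f • v) = Uq.gen q Gen.f • T v)
    (hk : ∀ v, T (Uq.gen q Gen.k • v) = Uq.gen q Gen.k • T v) : V →ₗ[Uq q] W where
  toFun := T
  map_add' := map_add T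
  map_smul' u := by
    have hkInv : ∀ v, T (Uq.gen q Gen.kInv • v) = Uq.gen q Gen.kInv • T v := fun v => by
      have h := congrArg (fun w => Uq.gen q Gen.kInv • w) (hk (Uq.gen q Gen.kInv • v))
      simpa only [← mul_smul, Uq.k_mul_kInv, Uq.kInv_mul_k, one_smul] using h.symm
    change ∀ v, T (u • v) = u • T v
    induction u using Uq.induction with
    | algebraMap c => intro v; rw [algebraMap_smul, algebraMap_smul, map_smul]
    | gen g => cases g <;> assumption
    | add x y hx hy => intro v; rw [add_smul, add_smul, map_add, hx, hy]
    | mul x y hx hy => intro v; rw [mul_smul, mul_smul, hx, hy]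

@[simp] theorem homOfGens_apply (T : V →ₗ[ℂ] W) (he hf hk) (v : V) :
    homOfGens (q := q) T he hf hk v = T v := rfl

end Hom

/-! ### The element `S`, whose square is the Casimir element -/

namespace RootDatum

variable (D : RootDatum)

/-- `S = q^{1/2} k - q^{-1/2} k⁻¹ - η f e`; it commutes with `k` and anticommutes with `e`, `f`. -/
noncomputable def S : Uq D.q :=
  D.s • Uq.gen D.q Gen.k - D.s⁻¹ • Uq.gen D.q Gen.kInv -
    D.η • (Uq.gen D.q Gen.f * Uq.gen D.q Gen.e)

theorem kInv_mul_e :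
    Uq.gen D.q Gen.kInv * Uq.gen D.q Gen.e = D.q⁻¹ • (Uq.gen D.q Gen.e * Uq.gen D.q Gen.kInv) :=
  Uq.kInv_mul_of_k_mul D.q_ne_zero Uq.k_mul_e

theorem kInv_mul_f :
    Uq.gen D.q Gen.kInv * Uq.gen D.q Gen.f = D.q • (Uq.gen D.q Gen.f * Uq.gen D.q Gen.kInv) := by
  have h := Uq.kInv_mul_of_k_mul (inv_ne_zero D.q_ne_zero) (Uq.k_mul_f (q := D.q))
  rwa [inv_inv] at h

theorem η_smul_f_mul_e :
    D.η • (Uq.gen D.q Gen.f * Uq.gen D.q Gen.e) =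
      D.s • Uq.gen D.q Gen.k - D.s⁻¹ • Uq.gen D.q Gen.kInv - D.S := by
  unfold S; abel

/-- `η` is normalised so that `η (q - q⁻¹)⁻¹ = s + s⁻¹`. Passing from `f e` to `e f` then only
exchanges `s` with `s⁻¹` and reverses the sign of `S`. -/
theorem η_smul_e_mul_f :
    D.η • (Uq.gen D.q Gen.e * Uq.gen D.q Gen.f) =
      D.s⁻¹ • Uq.gen D.q Gen.k - D.s • Uq.gen D.q Gen.kInv + D.S := by
  have h := D.q_sub_ne_zero
  rw [Uq.e_mul_f, smul_sub, smul_smul, η, mul_assoc, mul_inv_cancel₀ h, mul_one, ← η]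
  unfold S
  module

theorem commute_k_S : Commute (Uq.gen D.q Gen.k) D.S := by
  have h1 : Commute (Uq.gen D.q Gen.k) (Uq.gen D.q Gen.kInv) := by
    rw [commute_iff_eq, Uq.k_mul_kInv, Uq.kInv_mul_k]
  have h2 : Commute (Uq.gen D.q Gen.k) (Uq.gen D.q Gen.f * Uq.gen D.q Gen.e) := by
    rw [commute_iff_eq, ← mul_assoc, Uq.k_mul_f, smul_mul_assoc, mul_assoc, Uq.k_mul_e,
      mul_smul_comm, smul_smul, inv_mul_cancel₀ D.q_ne_zero, one_smul, mul_assoc]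
  exact (((Commute.refl _).smul_right _).sub_right (h1.smul_right _)).sub_right (h2.smul_right _)

/-- In `S f` the last term is `f (e f)`, which is rewritten by `η_smul_e_mul_f`. Because `q = s ^
2`, moving `k` past `f` turns `s` into `s⁻¹`, so the terms in `k` and `k⁻¹` combine to those of `-f
S`. -/
theorem S_mul_f : D.S * Uq.gen D.q Gen.f = -(Uq.gen D.q Gen.f * D.S) := by
  have h1 := congrArg (fun x => Uq.gen D.q Gen.f * x) D.η_smul_e_mul_f
  simp only [mul_smul_comm, mul_add, mul_sub] at h1
  have h2 : D.S * Uq.gen D.q Gen.f = D.s • (Uq.gen D.q Gen.k * Uq.gen D.q Gen.f) -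
      D.s⁻¹ • (Uq.gen D.q Gen.kInv * Uq.gen D.q Gen.f) -
      D.η • (Uq.gen D.q Gen.f * (Uq.gen D.q Gen.e * Uq.gen D.q Gen.f)) := by
    unfold S; simp only [sub_mul, smul_mul_assoc, mul_assoc]
  have hs := D.s_ne_zero
  have e1 : D.s * D.q⁻¹ = D.s⁻¹ := by rw [← D.s_sq]; field_simp
  have e2 : D.s⁻¹ * D.q = D.s := by rw [← D.s_sq]; field_simp
  rw [h2, h1, Uq.k_mul_f, D.kInv_mul_f, smul_smul, smul_smul, e1, e2]
  abel

theorem S_mul_e : D.S * Uq.gen D.q Gen.e = -(Uq.gen D.q Gen.e * D.S) := by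
  have h1 := congrArg (fun x => x * Uq.gen D.q Gen.e) D.η_smul_e_mul_f
  simp only [smul_mul_assoc, add_mul, sub_mul] at h1
  have h2 : Uq.gen D.q Gen.e * D.S = D.s • (Uq.gen D.q Gen.e * Uq.gen D.q Gen.k) -
      D.s⁻¹ • (Uq.gen D.q Gen.e * Uq.gen D.q Gen.kInv) -
      D.η • (Uq.gen D.q Gen.e * Uq.gen D.q Gen.f * Uq.gen D.q Gen.e) := by
    unfold S; simp only [mul_sub, mul_smul_comm, mul_assoc]
  have hs := D.s_ne_zero
  have e1 : D.s * D.q⁻¹ = D.s⁻¹ := by rw [← D.s_sq]; field_simp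
  have e2 : D.s⁻¹ * D.q = D.s := by rw [← D.s_sq]; field_simp
  rw [h2, h1, Uq.k_mul_e, D.kInv_mul_e, smul_smul, smul_smul, e1, e2]
  abel

/-! ### Powers of the generators -/

theorem k_mul_f_pow (n : ℕ) : Uq.gen D.q Gen.k * Uq.gen D.q Gen.f ^ n =
    (D.q⁻¹) ^ n • (Uq.gen D.q Gen.f ^ n * Uq.gen D.q Gen.k) := by
  induction n with
  | zero => simp
  | succ n ih =>
    rw [pow_succ, ← mul_assoc, ih, smul_mul_assoc, mul_assoc, Uq.k_mul_f, mul_smul_comm, smul_smul,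
      pow_succ, mul_assoc]

theorem k_mul_e_pow (n : ℕ) : Uq.gen D.q Gen.k * Uq.gen D.q Gen.e ^ n =
    D.q ^ n • (Uq.gen D.q Gen.e ^ n * Uq.gen D.q Gen.k) := by
  induction n with
  | zero => simp
  | succ n ih =>
    rw [pow_succ, ← mul_assoc, ih, smul_mul_assoc, mul_assoc, Uq.k_mul_e, mul_smul_comm, smul_smul,
      pow_succ, mul_assoc]

theorem S_mul_f_pow (n : ℕ) :
    D.S * Uq.gen D.q Gen.f ^ n = (-1 : ℂ) ^ n • (Uq.gen D.q Gen.f ^ n * D.S) := by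
  induction n with
  | zero => simp
  | succ n ih =>
    rw [pow_succ, ← mul_assoc, ih, smul_mul_assoc, mul_assoc, S_mul_f, pow_succ, mul_neg, smul_neg,
      mul_neg_one, neg_smul, mul_assoc]

theorem S_mul_e_pow (n : ℕ) :
    D.S * Uq.gen D.q Gen.e ^ n = (-1 : ℂ) ^ n • (Uq.gen D.q Gen.e ^ n * D.S) := by
  induction n with
  | zero => simp
  | succ n ih =>
    rw [pow_succ, ← mul_assoc, ih, smul_mul_assoc, mul_assoc, S_mul_e, pow_succ, mul_neg, smul_neg,
      mul_neg_one, neg_smul, mul_assoc]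

theorem k_pow_mul_e (n : ℕ) : Uq.gen D.q Gen.k ^ n * Uq.gen D.q Gen.e =
    D.q ^ n • (Uq.gen D.q Gen.e * Uq.gen D.q Gen.k ^ n) := by
  induction n with
  | zero => simp
  | succ n ih =>
    rw [pow_succ, mul_assoc, Uq.k_mul_e, mul_smul_comm, ← mul_assoc, ih, smul_mul_assoc, smul_smul,
      pow_succ', mul_assoc]

theorem k_pow_mul_f (n : ℕ) : Uq.gen D.q Gen.k ^ n * Uq.gen D.q Gen.f =
    (D.q⁻¹) ^ n • (Uq.gen D.q Gen.f * Uq.gen D.q Gen.k ^ n) := by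
  induction n with
  | zero => simp
  | succ n ih =>
    rw [pow_succ, mul_assoc, Uq.k_mul_f, mul_smul_comm, ← mul_assoc, ih, smul_mul_assoc, smul_smul,
      pow_succ', mul_assoc]

theorem kInv_mul_f_pow (n : ℕ) : Uq.gen D.q Gen.kInv * Uq.gen D.q Gen.f ^ n =
    D.q ^ n • (Uq.gen D.q Gen.f ^ n * Uq.gen D.q Gen.kInv) := by
  have h := Uq.kInv_mul_of_k_mul (pow_ne_zero n (inv_ne_zero D.q_ne_zero)) (D.k_mul_f_pow n)
  rwa [← inv_pow, inv_inv] at h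

theorem kInv_mul_e_pow (n : ℕ) : Uq.gen D.q Gen.kInv * Uq.gen D.q Gen.e ^ n =
    (D.q⁻¹) ^ n • (Uq.gen D.q Gen.e ^ n * Uq.gen D.q Gen.kInv) := by
  have h := Uq.kInv_mul_of_k_mul (pow_ne_zero n D.q_ne_zero) (D.k_mul_e_pow n)
  rwa [← inv_pow] at h

/-- Only the leading `e f` is expanded; its three terms are then carried past `f ^ n`, each picking
up its own power. -/
theorem η_smul_e_mul_f_pow (n : ℕ) :
    D.η • (Uq.gen D.q Gen.e * Uq.gen D.q Gen.f ^ (n + 1)) = Uq.gen D.q Gen.f ^ n *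
      ((D.s⁻¹ * (D.q⁻¹) ^ n) • Uq.gen D.q Gen.k - (D.s * D.q ^ n) • Uq.gen D.q Gen.kInv +
        (-1 : ℂ) ^ n • D.S) := by
  rw [pow_succ', ← mul_assoc, ← smul_mul_assoc, η_smul_e_mul_f, add_mul, sub_mul, smul_mul_assoc,
    smul_mul_assoc, k_mul_f_pow, kInv_mul_f_pow, S_mul_f_pow]
  simp only [mul_add, mul_sub, mul_smul_comm, smul_smul]

theorem η_smul_f_mul_e_pow (n : ℕ) :
    D.η • (Uq.gen D.q Gen.f * Uq.gen D.q Gen.e ^ (n + 1)) = Uq.gen D.q Gen.e ^ n *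
      ((D.s * D.q ^ n) • Uq.gen D.q Gen.k - (D.s⁻¹ * (D.q⁻¹) ^ n) • Uq.gen D.q Gen.kInv -
        (-1 : ℂ) ^ n • D.S) := by
  rw [pow_succ', ← mul_assoc, ← smul_mul_assoc, η_smul_f_mul_e, sub_mul, sub_mul, smul_mul_assoc,
    smul_mul_assoc, k_mul_e_pow, kInv_mul_e_pow, S_mul_e_pow]
  simp only [mul_sub, mul_smul_comm, smul_smul]

/-! ### Central elements -/

theorem S_sq_mem_center : D.S ^ 2 ∈ Subalgebra.center ℂ (Uq D.q) := by
  refine Uq.mem_center ?_ ?_ (D.commute_k_S.pow_right 2)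
  · rw [commute_iff_eq, sq, mul_assoc, S_mul_e, mul_neg, ← mul_assoc, ← mul_assoc, S_mul_e,
      neg_mul, neg_neg]
  · rw [commute_iff_eq, sq, mul_assoc, S_mul_f, mul_neg, ← mul_assoc, ← mul_assoc, S_mul_f,
      neg_mul, neg_neg]

theorem k_pow_l_mem_center : Uq.gen D.q Gen.k ^ D.l ∈ Subalgebra.center ℂ (Uq D.q) := by
  have h := D.isPrimitiveRoot.pow_eq_one
  refine Uq.mem_center ?_ ?_ ((Commute.refl _).pow_right _)
  · rw [commute_iff_eq, k_pow_mul_e, h, one_smul]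
  · rw [commute_iff_eq, k_pow_mul_f, inv_pow, h, inv_one, one_smul]

theorem q_pow_half {n : ℕ} (hn : D.l = 2 * n) : D.q ^ n = -1 := by
  have h2 := D.two_lt_l
  have h : D.q ^ n ≠ 1 := D.isPrimitiveRoot.pow_ne_one_of_pos_of_lt (by omega) (by omega)
  have h' : (D.q ^ n) ^ 2 = 1 := by
    rw [← pow_mul, mul_comm, ← hn, D.isPrimitiveRoot.pow_eq_one]
  exact (mul_self_eq_one_iff.1 (by rw [← sq]; exact h')).resolve_left h

/-- As `q ^ n = -1`, the power `k ^ n` anticommutes with `e` and `f`, just as `S` does. This central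
element sees the sign of `σ`, which `S ^ 2` does not. -/
theorem S_mul_k_pow_mem_center {n : ℕ} (hn : D.l = 2 * n) :
    D.S * Uq.gen D.q Gen.k ^ n ∈ Subalgebra.center ℂ (Uq D.q) := by
  have h := D.q_pow_half hn
  refine Uq.mem_center ?_ ?_ (D.commute_k_S.mul_right ((Commute.refl _).pow_right _))
  · rw [commute_iff_eq, mul_assoc, k_pow_mul_e, h, neg_one_smul, mul_neg, ← mul_assoc, ← mul_assoc,
      S_mul_e, neg_mul, neg_neg]
  · rw [commute_iff_eq, mul_assoc, k_pow_mul_f, inv_pow, h, inv_neg_one, neg_one_smul, mul_neg,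
      ← mul_assoc, ← mul_assoc, S_mul_f, neg_mul, neg_neg]

theorem smul_cancel {M : Type*} [AddCommGroup M] [Module ℂ M] {x y : M}
    (h : D.η • x = D.η • y) : x = y :=
  smul_right_injective M D.η_ne_zero h

theorem exists_L : ∃ n, D.L = n + 1 ∧ (-1 : ℂ) ^ n = -1 ∧ D.q ^ n = D.q⁻¹ := by
  obtain ⟨n, hn⟩ : ∃ n, D.L = n + 1 := ⟨D.L - 1, by have := NeZero.ne D.L; omega⟩
  refine ⟨n, hn, ?_, ?_⟩
  · have h := D.even_L
    rw [hn, Nat.even_add_one, Nat.not_even_iff_odd] at h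
    exact h.neg_one_pow
  · have h := D.q_pow_L
    rw [hn, pow_succ] at h
    exact eq_inv_of_mul_eq_one_left h

theorem s_mul_q_inv : D.s * D.q⁻¹ = D.s⁻¹ := by
  have hs := D.s_ne_zero
  rw [← D.s_sq]; field_simp

theorem s_inv_mul_q : D.s⁻¹ * D.q = D.s := by
  have hs := D.s_ne_zero
  rw [← D.s_sq]; field_simp

/-- For `n = L - 1` one has `q ^ n = q⁻¹` and `(-1) ^ n = -1`, so the bracket in
`η_smul_e_mul_f_pow` becomes `η f e`. The evenness of `L` is needed for the sign of `S`. -/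
theorem f_pow_L_mem_center : Uq.gen D.q Gen.f ^ D.L ∈ Subalgebra.center ℂ (Uq D.q) := by
  refine Uq.mem_center ?_ ((Commute.refl _).pow_right _) ?_
  · obtain ⟨n, hn, h1, h2⟩ := D.exists_L
    rw [commute_iff_eq]
    apply D.smul_cancel
    rw [hn, η_smul_e_mul_f_pow, h1, inv_pow, h2, inv_inv, s_inv_mul_q, s_mul_q_inv, neg_one_smul,
      ← sub_eq_add_neg, ← η_smul_f_mul_e, mul_smul_comm, pow_succ, mul_assoc]
  · rw [commute_iff_eq, k_mul_f_pow, inv_pow, D.q_pow_L, inv_one, one_smul]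

theorem e_pow_L_mem_center : Uq.gen D.q Gen.e ^ D.L ∈ Subalgebra.center ℂ (Uq D.q) := by
  refine Uq.mem_center ((Commute.refl _).pow_right _) ?_ ?_
  · obtain ⟨n, hn, h1, h2⟩ := D.exists_L
    rw [commute_iff_eq]
    apply D.smul_cancel
    rw [hn, η_smul_f_mul_e_pow, h1, inv_pow, h2, inv_inv, s_inv_mul_q, s_mul_q_inv, neg_one_smul,
      sub_neg_eq_add, ← η_smul_e_mul_f, mul_smul_comm, pow_succ, mul_assoc]
  · rw [commute_iff_eq, k_mul_e_pow, D.q_pow_L, one_smul]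

end RootDatum

/-! ### Homomorphisms given on a basis -/

section Basis

variable {q : ℂ} {V W ι : Type*} [AddCommGroup V] [AddCommGroup W] [Module ℂ V] [Module ℂ W]
  [Module (Uq q) V] [Module (Uq q) W] [IsScalarTower ℂ (Uq q) V] [IsScalarTower ℂ (Uq q) W]

theorem exists_hom_of_basis (b : Module.Basis ι ℂ V) (g : ι → W)
    (he : ∀ i, b.constr ℂ g (Uq.gen q Gen.e • b i) = Uq.gen q Gen.e • g i)
    (hf : ∀ i, b.constr ℂ g (Uq.gen q Gen.f • b i) = Uq.gen q Gen.f • g i)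
    (hk : ∀ i, b.constr ℂ g (Uq.gen q Gen.k • b i) = Uq.gen q Gen.k • g i) :
    ∃ T : V →ₗ[Uq q] W, ∀ i, T (b i) = g i := by
  have key : ∀ u : Uq q, (∀ i, b.constr ℂ g (u • b i) = u • g i) →
      ∀ v, b.constr ℂ g (u • v) = u • b.constr ℂ g v := by
    intro u hu v
    have h : (b.constr ℂ g).comp (Algebra.lsmul ℂ ℂ V u) =
        (Algebra.lsmul ℂ ℂ W u).comp (b.constr ℂ g) := by
      refine b.ext fun i => ?_
      simp only [LinearMap.comp_apply, Algebra.lsmul_coe]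
      rw [hu i, b.constr_basis]
    exact LinearMap.congr_fun h v
  exact ⟨homOfGens (b.constr ℂ g) (key _ he) (key _ hf) (key _ hk), fun i => by
    rw [homOfGens_apply, b.constr_basis]⟩

/-- The kets, as a basis of a module. -/
noncomputable def ketBasis (ρ : Uq q →ₐ[ℂ] Module.End ℂ (ι →₀ ℂ)) :
    Module.Basis ι ℂ (AsModule ρ) :=
  (Finsupp.basisSingleOne : Module.Basis ι ℂ (ι →₀ ℂ))

theorem ketBasis_apply (ρ : Uq q →ₐ[ℂ] Module.End ℂ (ι →₀ ℂ)) (i : ι) :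
    ketBasis ρ i = (ket i : ι →₀ ℂ) := by
  unfold ketBasis ket
  exact congrFun (Finsupp.coe_basisSingleOne (R := ℂ)) i

theorem smul_ketBasis (ρ : Uq q →ₐ[ℂ] Module.End ℂ (ι →₀ ℂ)) {u : Uq q} {i j : ι} {c : ℂ}
    (h : ρ u (ket i) = c • ket j) : u • ketBasis ρ i = c • ketBasis ρ j := by
  rw [ketBasis_apply, ketBasis_apply]
  exact h

theorem smul_ketBasis_eq_zero (ρ : Uq q →ₐ[ℂ] Module.End ℂ (ι →₀ ℂ)) {u : Uq q} {i : ι}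
    (h : ρ u (ket i) = 0) : u • ketBasis ρ i = 0 := by
  rw [ketBasis_apply]
  exact h

end Basis

/-! ### Weight vectors -/

section Weight

variable (D : RootDatum) {W : Type*} [AddCommGroup W] [Module ℂ W] [Module (Uq D.q) W]

/-- A joint eigenvector of `k` and `S`. -/
structure IsWeight (v : W) (lam σ : ℂ) : Prop where
  k : Uq.gen D.q Gen.k • v = lam • v
  S : D.S • v = σ • v

variable {D} [IsScalarTower ℂ (Uq D.q) W] {v : W} {lam σ : ℂ}

theorem kInv_smul (h : Uq.gen D.q Gen.k • v = lam • v) :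
    Uq.gen D.q Gen.kInv • v = lam⁻¹ • v := by
  -- For `lam = 0` this forces `v = 0`, so the convention `0⁻¹ = 0` does no harm.
  have h1 : v = lam • Uq.gen D.q Gen.kInv • v := by
    rw [smul_comm, ← h, ← mul_smul, Uq.kInv_mul_k, one_smul]
  rcases eq_or_ne lam 0 with rfl | h0
  · rw [zero_smul] at h1
    rw [h1]; simp
  · conv_rhs => rw [h1]
    rw [smul_smul, inv_mul_cancel₀ h0, one_smul]

theorem k_smul_f_pow (h : Uq.gen D.q Gen.k • v = lam • v) (n : ℕ) :
    Uq.gen D.q Gen.k • Uq.gen D.q Gen.f ^ n • v =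
      (lam * (D.q ^ n)⁻¹) • Uq.gen D.q Gen.f ^ n • v := by
  rw [← mul_smul, D.k_mul_f_pow, smul_assoc, mul_smul, h, smul_comm _ lam, smul_smul, inv_pow,
    mul_comm]

theorem k_smul_e_pow (h : Uq.gen D.q Gen.k • v = lam • v) (n : ℕ) :
    Uq.gen D.q Gen.k • Uq.gen D.q Gen.e ^ n • v =
      (lam * D.q ^ n) • Uq.gen D.q Gen.e ^ n • v := by
  rw [← mul_smul, D.k_mul_e_pow, smul_assoc, mul_smul, h, smul_comm _ lam, smul_smul, mul_comm]

theorem IsWeight.f_pow (h : IsWeight D v lam σ) (n : ℕ) :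
    IsWeight D (Uq.gen D.q Gen.f ^ n • v) (lam * (D.q ^ n)⁻¹) (σ * (-1) ^ n) where
  k := k_smul_f_pow h.k n
  S := by
    rw [← mul_smul, D.S_mul_f_pow, smul_assoc, mul_smul, h.S, smul_comm _ σ, smul_smul, mul_comm]

theorem IsWeight.e_pow (h : IsWeight D v lam σ) (n : ℕ) :
    IsWeight D (Uq.gen D.q Gen.e ^ n • v) (lam * D.q ^ n) (σ * (-1) ^ n) where
  k := k_smul_e_pow h.k n
  S := by
    rw [← mul_smul, D.S_mul_e_pow, smul_assoc, mul_smul, h.S, smul_comm _ σ, smul_smul, mul_comm]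

/-- The coefficient is the eigenvalue of `W` used to define the listed modules, which is why they
map to any module with a suitable weight vector. -/
theorem IsWeight.e_smul_f_pow {lam : ℂˣ} (h : IsWeight D v lam σ) (n : ℕ) :
    Uq.gen D.q Gen.e • Uq.gen D.q Gen.f ^ (n + 1) • v =
      (D.η⁻¹ * D.nilw lam σ (n + 1)) • Uq.gen D.q Gen.f ^ n • v := by
  apply D.smul_cancel
  rw [← mul_smul, ← smul_assoc, D.η_smul_e_mul_f_pow, smul_smul, mul_inv_cancel_left₀ D.η_ne_zero,
    mul_smul, add_smul, sub_smul, smul_assoc, smul_assoc, smul_assoc, h.k, kInv_smul h.k, h.S,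
    smul_smul, smul_smul, smul_smul, ← sub_smul, ← add_smul,
    smul_comm (Uq.gen D.q Gen.f ^ n) (_ : ℂ)]
  congr 1
  have hs := D.s_ne_zero
  have hq := D.q_ne_zero
  unfold RootDatum.nilw
  rw [pow_succ, pow_succ (-1 : ℂ), inv_pow]
  have hm : D.q ^ n ≠ 0 := pow_ne_zero _ hq
  have hl : (lam : ℂ) ≠ 0 := lam.ne_zero
  generalize D.q ^ n = x at hm ⊢
  rw [← D.s_sq]
  field_simp
  ring

theorem IsWeight.f_smul_e_pow {lam : ℂˣ} (h : IsWeight D v lam σ) (n : ℕ) :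
    Uq.gen D.q Gen.f • Uq.gen D.q Gen.e ^ (n + 1) • v =
      (D.η⁻¹ * (D.s * lam * D.q ^ n - D.s⁻¹ * (lam : ℂ)⁻¹ * (D.q ^ n)⁻¹ - σ * (-1) ^ n)) •
        Uq.gen D.q Gen.e ^ n • v := by
  apply D.smul_cancel
  rw [← mul_smul, ← smul_assoc, D.η_smul_f_mul_e_pow, smul_smul, mul_inv_cancel_left₀ D.η_ne_zero,
    mul_smul, sub_smul, sub_smul, smul_assoc, smul_assoc, smul_assoc, h.k, kInv_smul h.k, h.S,
    smul_smul, smul_smul, smul_smul, ← sub_smul, ← sub_smul,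
    smul_comm (Uq.gen D.q Gen.e ^ n) (_ : ℂ), inv_pow]
  congr 1
  ring

/-- `S` is a combination of `k`, `k⁻¹` and `f e`, so its eigenvalue can be read off from theirs. -/
theorem isWeight_of_f_smul_e {lam : ℂˣ} (hk : Uq.gen D.q Gen.k • v = (lam : ℂ) • v)
    (hfe : Uq.gen D.q Gen.f • Uq.gen D.q Gen.e • v =
      (D.η⁻¹ * (D.s * lam - D.s⁻¹ * (lam : ℂ)⁻¹ - σ)) • v) : IsWeight D v lam σ where
  k := hk
  S := by
    rw [RootDatum.S, sub_smul, sub_smul, smul_assoc, smul_assoc, smul_assoc, mul_smul, hk,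
      kInv_smul hk, hfe, smul_smul, smul_smul, smul_smul, mul_inv_cancel_left₀ D.η_ne_zero,
      ← sub_smul, ← sub_smul]
    congr 1
    ring

/-- A nontrivial finite-dimensional module contains a joint eigenvector of `k` and `S`. -/
theorem exists_isWeight (D : RootDatum) (W : Type*) [AddCommGroup W] [Module ℂ W]
    [Module (Uq D.q) W] [IsScalarTower ℂ (Uq D.q) W] [FiniteDimensional ℂ W] [Nontrivial W] :
    ∃ (v : W) (lam : ℂˣ) (σ : ℂ), v ≠ 0 ∧ IsWeight D v lam σ := by
  obtain ⟨lam, hlam⟩ := Module.End.exists_eigenvalue (Algebra.lsmul ℂ ℂ W (Uq.gen D.q Gen.k))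
  set E := Module.End.eigenspace (Algebra.lsmul ℂ ℂ W (Uq.gen D.q Gen.k)) lam with hE
  have hmem : ∀ v, v ∈ E ↔ Uq.gen D.q Gen.k • v = lam • v := fun v => by
    rw [hE, Module.End.mem_eigenspace_iff]; rfl
  have hS : ∀ v ∈ E, Algebra.lsmul ℂ ℂ W D.S v ∈ E := by
    intro v hv
    rw [hmem] at hv ⊢
    change Uq.gen D.q Gen.k • D.S • v = lam • D.S • v
    rw [← mul_smul, D.commute_k_S.eq, mul_smul, hv, smul_comm]
  have hE0 : E ≠ ⊥ := hlam
  have : Nontrivial E := Submodule.nontrivial_iff_ne_bot.2 hE0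
  obtain ⟨σ, hσ⟩ := Module.End.exists_eigenvalue ((Algebra.lsmul ℂ ℂ W D.S).restrict hS)
  obtain ⟨⟨v, hv⟩, hv'⟩ := hσ.exists_hasEigenvector
  have hv0 : v ≠ 0 := fun h => hv'.2 (Subtype.ext h)
  have hk := (hmem v).1 hv
  have hlam0 : lam ≠ 0 := by
    rintro rfl
    apply hv0
    rw [zero_smul] at hk
    rw [← one_smul (Uq D.q) v, ← Uq.kInv_mul_k, mul_smul, hk, smul_zero]
  exact ⟨v, Units.mk0 lam hlam0, σ, hv0, hk, congrArg Subtype.val hv'.apply_eq_smul⟩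

/-- A nontrivial finite-dimensional module where `e` is nilpotent contains a highest weight
vector. -/
theorem exists_highestWeight (D : RootDatum) (W : Type*) [AddCommGroup W] [Module ℂ W]
    [Module (Uq D.q) W] [IsScalarTower ℂ (Uq D.q) W] [FiniteDimensional ℂ W] [Nontrivial W]
    (he : ∃ n, ∀ v : W, Uq.gen D.q Gen.e ^ n • v = 0) :
    ∃ (v : W) (lam : ℂˣ), v ≠ 0 ∧ Uq.gen D.q Gen.e • v = 0 ∧
      Uq.gen D.q Gen.k • v = (lam : ℂ) • v := by
  classical
  obtain ⟨v, lam, σ, hv, hw⟩ := exists_isWeight D W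
  have hex : ∃ n, Uq.gen D.q Gen.e ^ n • v = 0 := he.imp fun n hn => hn v
  obtain ⟨n, hn⟩ : ∃ n, Nat.find hex = n + 1 := by
    refine Nat.exists_eq_succ_of_ne_zero fun h => hv ?_
    have := Nat.find_spec hex
    rwa [h, pow_zero, one_smul] at this
  refine ⟨Uq.gen D.q Gen.e ^ n • v, lam * (Units.mk0 D.q D.q_ne_zero) ^ n,
    Nat.find_min hex (by omega), ?_, ?_⟩
  · rw [← mul_smul, ← pow_succ', ← hn]
    exact Nat.find_spec hex
  · rw [k_smul_e_pow hw.k]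
    simp

end Weight

/-! ### The action on the kets of the listed modules -/

namespace RootDatum

variable (D : RootDatum)

section Cyclic

variable {N : ℕ} [NeZero N] (hN : D.q ^ N = 1) (lam φ : ℂˣ) (σ : ℂ) (hσ : σ = 0 ∨ Even N)
  (m : ZMod N)

/-- `cycw` at `m` is by definition `nilw` at the representative `m.val`; using `nilw` throughout
lets one weight function serve periodic and nilpotent modules. -/
theorem cycPlus_e : Uq.gen D.q Gen.e • ketBasis (D.cycPlus N hN lam φ σ hσ) m =
    ((D.η * φ)⁻¹ * D.nilw lam σ m.val) • ketBasis (D.cycPlus N hN lam φ σ hσ) (m - 1) := by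
  apply smul_ketBasis
  rw [cycPlus, (Uq.rep_gen _ _ _ _ _ _ _ _ _ _).1, LinearMap.smul_apply, Module.End.mul_apply,
    cycW_ket, map_smul, cycPInv, onKets_ket, smul_smul]
  rfl

theorem cycPlus_f : Uq.gen D.q Gen.f • ketBasis (D.cycPlus N hN lam φ σ hσ) m =
    (φ : ℂ) • ketBasis (D.cycPlus N hN lam φ σ hσ) (m + 1) := by
  apply smul_ketBasis
  rw [cycPlus, (Uq.rep_gen _ _ _ _ _ _ _ _ _ _).2.1, LinearMap.smul_apply, cycP, onKets_ket]

theorem cycPlus_k : Uq.gen D.q Gen.k • ketBasis (D.cycPlus N hN lam φ σ hσ) m =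
    (lam * (D.q ^ m.val)⁻¹ : ℂ) • ketBasis (D.cycPlus N hN lam φ σ hσ) m := by
  apply smul_ketBasis
  rw [cycPlus, (Uq.rep_gen _ _ _ _ _ _ _ _ _ _).2.2.1, LinearMap.smul_apply, cycQ, onKets_ket,
    smul_smul, inv_pow]

theorem cycMinus_e : Uq.gen D.q Gen.e • ketBasis (D.cycMinus N hN lam φ σ hσ) m =
    (φ : ℂ) • ketBasis (D.cycMinus N hN lam φ σ hσ) (m - 1) := by
  apply smul_ketBasis
  rw [cycMinus, (Uq.rep_gen _ _ _ _ _ _ _ _ _ _).1, LinearMap.smul_apply, cycPInv, onKets_ket]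

theorem cycMinus_f : Uq.gen D.q Gen.f • ketBasis (D.cycMinus N hN lam φ σ hσ) m =
    ((D.η * φ)⁻¹ * D.nilw lam σ (m + 1).val) •
      ketBasis (D.cycMinus N hN lam φ σ hσ) (m + 1) := by
  apply smul_ketBasis
  rw [cycMinus, (Uq.rep_gen _ _ _ _ _ _ _ _ _ _).2.1, LinearMap.smul_apply, Module.End.mul_apply,
    cycP, onKets_ket, cycW_ket, smul_smul]
  rfl

theorem cycMinus_k : Uq.gen D.q Gen.k • ketBasis (D.cycMinus N hN lam φ σ hσ) m =
    (lam * (D.q ^ m.val)⁻¹ : ℂ) • ketBasis (D.cycMinus N hN lam φ σ hσ) m := by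
  apply smul_ketBasis
  rw [cycMinus, (Uq.rep_gen _ _ _ _ _ _ _ _ _ _).2.2.1, LinearMap.smul_apply, cycQ, onKets_ket,
    smul_smul, inv_pow]

end Cyclic

section Nilpotent

variable {d : ℕ} {lam : ℂˣ} (h : D.Quantised d lam)

theorem nil_e_zero (hd : 0 < d) :
    Uq.gen D.q Gen.e • ketBasis (D.nil d lam h) ⟨0, hd⟩ = 0 := by
  apply smul_ketBasis_eq_zero
  rw [nil, (Uq.rep_gen _ _ _ _ _ _ _ _ _ _).1, LinearMap.smul_apply, Module.End.mul_apply,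
    nilW_ket, map_smul, nilP', onKets_ket, if_pos rfl, smul_zero, smul_zero]

theorem nil_e_succ {m : ℕ} (hm : m + 1 < d) :
    Uq.gen D.q Gen.e • ketBasis (D.nil d lam h) ⟨m + 1, hm⟩ =
      (D.η⁻¹ * D.nilw lam (D.nilσ lam) (m + 1)) •
        ketBasis (D.nil d lam h) ⟨m, by omega⟩ := by
  apply smul_ketBasis
  rw [nil, (Uq.rep_gen _ _ _ _ _ _ _ _ _ _).1, LinearMap.smul_apply, Module.End.mul_apply,
    nilW_ket, map_smul, nilP', onKets_ket, if_neg (Nat.succ_ne_zero m), smul_smul]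
  rfl

theorem nil_f {m : ℕ} (hm : m + 1 < d) :
    Uq.gen D.q Gen.f • ketBasis (D.nil d lam h) ⟨m, by omega⟩ =
      ketBasis (D.nil d lam h) ⟨m + 1, hm⟩ := by
  rw [← one_smul ℂ (ketBasis (D.nil d lam h) ⟨m + 1, hm⟩)]
  apply smul_ketBasis
  rw [nil, (Uq.rep_gen _ _ _ _ _ _ _ _ _ _).2.1, nilP, onKets_ket, dif_pos hm, one_smul]

theorem nil_f_last {m : ℕ} (hm : m < d) (hd : m + 1 = d) :
    Uq.gen D.q Gen.f • ketBasis (D.nil d lam h) ⟨m, hm⟩ = 0 := by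
  apply smul_ketBasis_eq_zero
  rw [nil, (Uq.rep_gen _ _ _ _ _ _ _ _ _ _).2.1, nilP, onKets_ket, dif_neg (by simp [hd])]

theorem nil_k (m : Fin d) : Uq.gen D.q Gen.k • ketBasis (D.nil d lam h) m =
    (lam * (D.q ^ (m : ℕ))⁻¹ : ℂ) • ketBasis (D.nil d lam h) m := by
  apply smul_ketBasis
  rw [nil, (Uq.rep_gen _ _ _ _ _ _ _ _ _ _).2.2.1, LinearMap.smul_apply, nilQ, onKets_ket,
    smul_smul, inv_pow]

end Nilpotent

end RootDatum

/-! ### Universal properties of the listed modules -/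

theorem pow_val_natCast {z : ℂ} {N : ℕ} (hz : z ^ N = 1) (n : ℕ) :
    z ^ (n : ZMod N).val = z ^ n := by
  rw [ZMod.val_natCast, ← pow_eq_pow_mod _ hz]

theorem pow_val_neg_natCast {z : ℂ} {N : ℕ} [NeZero N] (hz : z ^ N = 1) (n : ℕ) :
    z ^ (-(n : ZMod N)).val = (z ^ n)⁻¹ := by
  apply eq_inv_of_mul_eq_one_left
  rw [← pow_add, ← pow_val_natCast hz]
  simp

/-- For odd `N` the sign `(-1) ^ m` is not well defined modulo `N`, but then `σ = 0`. -/
theorem mul_neg_one_pow_val_natCast {N : ℕ} {σ : ℂ} (hσ : σ = 0 ∨ Even N) (n : ℕ) :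
    σ * (-1) ^ (n : ZMod N).val = σ * (-1) ^ n := by
  rcases hσ with rfl | h
  · simp
  · rw [pow_val_natCast h.neg_one_pow]

theorem mul_neg_one_pow_val_neg_natCast {N : ℕ} [NeZero N] {σ : ℂ} (hσ : σ = 0 ∨ Even N) (n : ℕ) :
    σ * (-1) ^ (-(n : ZMod N)).val = σ * (-1) ^ n := by
  rcases hσ with rfl | h
  · simp
  · rw [pow_val_neg_natCast h.neg_one_pow, ← inv_pow, inv_neg_one]

section Universal

variable {D : RootDatum} {W : Type*} [AddCommGroup W] [Module ℂ W] [Module (Uq D.q) W]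
  [IsScalarTower ℂ (Uq D.q) W] {v : W} {lam : ℂˣ} {σ : ℂ}

/-- If `u ^ N` multiplies `v` by `c ^ N`, then `c⁻ⁿ uⁿ v` depends on `n` modulo `N` only. -/
theorem pow_smul_val_natCast {u : Uq D.q} {c : ℂˣ} {N : ℕ} (h : u ^ N • v = (c : ℂ) ^ N • v)
    (n : ℕ) : ((c : ℂ)⁻¹) ^ (n : ZMod N).val • u ^ (n : ZMod N).val • v =
      ((c : ℂ)⁻¹) ^ n • u ^ n • v := by
  have hper : Function.Periodic (fun n : ℕ => ((c : ℂ)⁻¹) ^ n • u ^ n • v) N := by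
    intro n
    have hc : (c : ℂ) ≠ 0 := c.ne_zero
    simp only
    rw [pow_add, pow_add, mul_smul (u ^ n), h, smul_comm (u ^ n) (_ : ℂ), smul_smul]
    rw [mul_assoc, ← mul_pow, inv_mul_cancel₀ hc, one_pow, mul_one]
  rw [ZMod.val_natCast]
  exact hper.map_mod_nat n

/-- The map sends `|n⟩` to `φ⁻ⁿ fⁿ v`. The hypothesis on `f ^ N • v` makes this periodic in `n`, and
`q ^ N = 1` with `hσ` does the same for the weights. -/
theorem exists_hom_cycPlus {N : ℕ} [NeZero N] (hN : D.q ^ N = 1) {φ : ℂˣ}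
    (hσ : σ = 0 ∨ Even N) (hv : IsWeight D v lam σ)
    (hf : Uq.gen D.q Gen.f ^ N • v = (φ : ℂ) ^ N • v) :
    ∃ T : AsModule (D.cycPlus N hN lam φ σ hσ) →ₗ[Uq D.q] W,
      ∀ m, T (ketBasis _ m) = ((φ : ℂ)⁻¹) ^ m.val • Uq.gen D.q Gen.f ^ m.val • v := by
  have hφ : (φ : ℂ) ≠ 0 := φ.ne_zero
  apply exists_hom_of_basis
  · intro m
    -- Every residue is a successor, so the formula for `e f ^ (n + 1)` applies and no wrap-around
    -- case arises.
    obtain ⟨n, rfl⟩ : ∃ n : ℕ, m = ((n + 1 : ℕ) : ZMod N) := ⟨(m - 1).val, by simp⟩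
    rw [D.cycPlus_e, map_smul, Module.Basis.constr_basis]
    have h1 : (((n + 1 : ℕ) : ZMod N) - 1) = (n : ZMod N) := by simp
    rw [h1, pow_smul_val_natCast hf, pow_smul_val_natCast hf,
      smul_comm (Uq.gen D.q Gen.e) (_ : ℂ), hv.e_smul_f_pow, smul_smul, smul_smul, RootDatum.nilw, RootDatum.nilw,
      pow_val_natCast hN, mul_neg_one_pow_val_natCast hσ]
    congr 1
    rw [pow_succ (φ : ℂ)⁻¹, mul_inv]
    ring
  · intro m
    obtain ⟨n, rfl⟩ : ∃ n : ℕ, m = (n : ZMod N) := ⟨m.val, by simp⟩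
    rw [D.cycPlus_f, map_smul, Module.Basis.constr_basis]
    rw [← Nat.cast_succ, pow_smul_val_natCast hf, pow_smul_val_natCast hf,
      smul_comm (Uq.gen D.q Gen.f) (_ : ℂ), ← mul_smul (Uq.gen D.q Gen.f), ← pow_succ', smul_smul, pow_succ', mul_inv_cancel_left₀ hφ]
  · intro m
    rw [D.cycPlus_k, map_smul, Module.Basis.constr_basis, smul_comm (Uq.gen D.q Gen.k) (_ : ℂ),
      k_smul_f_pow hv.k, smul_comm]

/-- Since `e` lowers the index, the ket at `-n` goes to `ε⁻ⁿ eⁿ v`; this is the source of the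
negated indices. -/
theorem exists_hom_cycMinus {N : ℕ} [NeZero N] (hN : D.q ^ N = 1) {ε : ℂˣ}
    (hσ : σ = 0 ∨ Even N) (hv : IsWeight D v lam σ)
    (he : Uq.gen D.q Gen.e ^ N • v = (ε : ℂ) ^ N • v) :
    ∃ T : AsModule (D.cycMinus N hN lam ε σ hσ) →ₗ[Uq D.q] W,
      ∀ m, T (ketBasis _ m) = ((ε : ℂ)⁻¹) ^ (-m).val • Uq.gen D.q Gen.e ^ (-m).val • v := by
  have hε : (ε : ℂ) ≠ 0 := ε.ne_zero
  apply exists_hom_of_basis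
  · intro m
    obtain ⟨n, rfl⟩ : ∃ n : ℕ, m = -(n : ZMod N) := ⟨(-m).val, by simp⟩
    rw [D.cycMinus_e, map_smul, Module.Basis.constr_basis]
    have h1 : (-(-(n : ZMod N) - 1)) = ((n + 1 : ℕ) : ZMod N) := by push_cast; ring
    rw [h1, neg_neg, pow_smul_val_natCast he, pow_smul_val_natCast he,
      smul_comm (Uq.gen D.q Gen.e) (_ : ℂ), ← mul_smul (Uq.gen D.q Gen.e), ← pow_succ', smul_smul, pow_succ', mul_inv_cancel_left₀ hε]
  · intro m
    obtain ⟨n, rfl⟩ : ∃ n : ℕ, m = -((n + 1 : ℕ) : ZMod N) := ⟨(-m - 1).val, by simp⟩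
    rw [D.cycMinus_f, map_smul, Module.Basis.constr_basis]
    have h1 : -((n + 1 : ℕ) : ZMod N) + 1 = -(n : ZMod N) := by push_cast; ring
    rw [h1, neg_neg, neg_neg, pow_smul_val_natCast he, pow_smul_val_natCast he,
      smul_comm (Uq.gen D.q Gen.f) (_ : ℂ), hv.f_smul_e_pow, smul_smul, smul_smul, RootDatum.nilw,
      pow_val_neg_natCast hN, mul_neg_one_pow_val_neg_natCast hσ, inv_inv]
    congr 1
    rw [pow_succ (ε : ℂ)⁻¹, mul_inv]
    ring
  · intro m
    obtain ⟨n, rfl⟩ : ∃ n : ℕ, m = -(n : ZMod N) := ⟨(-m).val, by simp⟩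
    rw [D.cycMinus_k, map_smul, Module.Basis.constr_basis, smul_comm (Uq.gen D.q Gen.k) (_ : ℂ),
      neg_neg, k_smul_e_pow hv.k, smul_comm, pow_val_natCast hN, pow_val_neg_natCast hN, inv_inv]

theorem isWeight_of_highestWeight (hk : Uq.gen D.q Gen.k • v = (lam : ℂ) • v)
    (he : Uq.gen D.q Gen.e • v = 0) : IsWeight D v lam (D.nilσ lam) := by
  apply isWeight_of_f_smul_e hk
  rw [he, smul_zero, RootDatum.nilσ, sub_self, mul_zero, zero_smul]

theorem exists_hom_nil {d : ℕ} (h : D.Quantised d lam)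
    (hk : Uq.gen D.q Gen.k • v = (lam : ℂ) • v) (he : Uq.gen D.q Gen.e • v = 0)
    (hf : Uq.gen D.q Gen.f ^ d • v = 0) :
    ∃ T : AsModule (D.nil d lam h) →ₗ[Uq D.q] W,
      ∀ m, T (ketBasis _ m) = Uq.gen D.q Gen.f ^ (m : ℕ) • v := by
  have hw := isWeight_of_highestWeight hk he
  apply exists_hom_of_basis
  · rintro ⟨m, hm⟩
    rcases m with _ | m
    · rw [D.nil_e_zero, map_zero]
      simp [he]
    · rw [D.nil_e_succ, map_smul, Module.Basis.constr_basis, hw.e_smul_f_pow]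
  · rintro ⟨m, hm⟩
    rw [← mul_smul, ← pow_succ']
    by_cases hd : m + 1 < d
    · rw [D.nil_f h hd, Module.Basis.constr_basis]
    · have hd' : m + 1 = d := by omega
      rw [D.nil_f_last h hm hd', map_zero, hd', hf]
  · intro m
    rw [D.nil_k, map_smul, Module.Basis.constr_basis, k_smul_f_pow hk]

end Universal

/-! ### Ladders -/

section Ladder

variable (D : RootDatum) {V W : Type*} [AddCommGroup V] [Module ℂ V] [Module (Uq D.q) V]
  [AddCommGroup W] [Module ℂ W] [Module (Uq D.q) W]

/-- A basis of weight vectors, indexed modulo `N`, along which `e` and `f` move in opposite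
directions. -/
structure IsLadder {N : ℕ} (b : Module.Basis (ZMod N) ℂ V) (lam : ℂˣ) (σ : ℂ) : Prop where
  weight : ∀ m, IsWeight D (b m) (lam * (D.q ^ m.val)⁻¹) (σ * (-1) ^ m.val)
  e : ∀ m, ∃ a : ℂ, Uq.gen D.q Gen.e • b m = a • b (m - 1)
  f : ∀ m, ∃ a : ℂ, Uq.gen D.q Gen.f • b m = a • b (m + 1)

variable {D} {N : ℕ} {b : Module.Basis (ZMod N) ℂ V} {lam : ℂˣ} {σ : ℂ}

theorem IsLadder.weight_zero (hb : IsLadder D b lam σ) : IsWeight D (b 0) lam σ := by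
  simpa using hb.weight 0

/-- A power of `u` is an invertible scalar, so `u` is injective. -/
theorem pow_smul_ne_zero {u : Uq D.q} {c : ℂˣ} [NeZero N]
    (h : ∀ w : W, u ^ N • w = (c : ℂ) • w) (n : ℕ) {w : W} (hw : w ≠ 0) : u ^ n • w ≠ 0 := by
  have h1 : ∀ w : W, u • w = 0 → w = 0 := by
    intro w hw
    have h2 := h w
    obtain ⟨k, hk⟩ := Nat.exists_eq_succ_of_ne_zero (NeZero.ne N)
    rw [hk, pow_succ, mul_smul, hw, smul_zero] at h2
    exact (smul_eq_zero.1 h2.symm).resolve_left c.ne_zero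
  induction n with
  | zero => simpa using hw
  | succ n ih =>
    rw [pow_succ', mul_smul]
    exact fun h2 => ih (h1 _ h2)

variable [IsScalarTower ℂ (Uq D.q) V] [IsScalarTower ℂ (Uq D.q) W]

theorem IsLadder.map (hb : IsLadder D b lam σ) (T : V ≃ₗ[Uq D.q] W) :
    IsLadder D (b.map (T.restrictScalars ℂ)) lam σ := by
  have hT : ∀ m, b.map (T.restrictScalars ℂ) m = T (b m) := fun m => rfl
  have hs : ∀ (c : ℂ) x, T (c • x) = c • T x := fun c x => (T.restrictScalars ℂ).map_smul c x
  refine ⟨fun m => ⟨?_, ?_⟩, fun m => ?_, fun m => ?_⟩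
  · rw [hT, ← map_smul, (hb.weight m).k, hs]
  · rw [hT, ← map_smul, (hb.weight m).S, hs]
  · obtain ⟨a, ha⟩ := hb.e m
    exact ⟨a, by rw [hT, hT, ← map_smul, ha, hs]⟩
  · obtain ⟨a, ha⟩ := hb.f m
    exact ⟨a, by rw [hT, hT, ← map_smul, ha, hs]⟩

theorem IsLadder.f_pow (hb : IsLadder D b lam σ) (n : ℕ) (m : ZMod N) :
    ∃ a : ℂ, Uq.gen D.q Gen.f ^ n • b m = a • b (m + n) := by
  induction n with
  | zero => exact ⟨1, by simp⟩
  | succ n ih =>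
    obtain ⟨a, ha⟩ := ih
    obtain ⟨a', ha'⟩ := hb.f (m + n)
    refine ⟨a * a', ?_⟩
    rw [pow_succ', mul_smul, ha, smul_comm _ a, ha', smul_smul, Nat.cast_succ, add_assoc]

theorem IsLadder.e_pow (hb : IsLadder D b lam σ) (n : ℕ) (m : ZMod N) :
    ∃ a : ℂ, Uq.gen D.q Gen.e ^ n • b m = a • b (m - n) := by
  induction n with
  | zero => exact ⟨1, by simp⟩
  | succ n ih =>
    obtain ⟨a, ha⟩ := ih
    obtain ⟨a', ha'⟩ := hb.e (m - n)
    refine ⟨a * a', ?_⟩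
    rw [pow_succ', mul_smul, ha, smul_comm _ a, ha', smul_smul, Nat.cast_succ, sub_sub]

/-- Two different vectors of the ladder have different weights. -/
def Separated (D : RootDatum) (N : ℕ) (σ : ℂ) : Prop :=
  ∀ m n : ZMod N, D.q ^ m.val = D.q ^ n.val → σ * (-1) ^ m.val = σ * (-1) ^ n.val → m = n

theorem repr_smul_of_diagonal {q : ℂ} {ι V : Type*} [AddCommGroup V] [Module ℂ V] [Module (Uq q) V]
    [IsScalarTower ℂ (Uq q) V] (b : Module.Basis ι ℂ V) {u : Uq q} {c : ι → ℂ}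
    (h : ∀ i, u • b i = c i • b i) (x : V) (i : ι) : b.repr (u • x) i = c i * b.repr x i := by
  have h1 : (b.coord i).comp (Algebra.lsmul ℂ ℂ V u) = c i • b.coord i := by
    refine b.ext fun j => ?_
    by_cases hij : j = i
    · subst hij; simp [h]
    · simp [h, hij]
  exact LinearMap.congr_fun h1 x

theorem eq_top_of_basis_mem {q : ℂ} {ι V : Type*} [AddCommGroup V] [Module ℂ V] [Module (Uq q) V]
    [IsScalarTower ℂ (Uq q) V] (b : Module.Basis ι ℂ V) (M : Submodule (Uq q) V)
    (h : ∀ i, b i ∈ M) : M = ⊤ := by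
  have htop : M.restrictScalars ℂ = ⊤ := by
    rw [eq_top_iff, ← b.span_eq, Submodule.span_le]
    rintro _ ⟨n, rfl⟩
    exact h n
  rw [eq_top_iff]
  intro y _
  have : y ∈ M.restrictScalars ℂ := htop ▸ Submodule.mem_top
  exact this

/-- A nonzero submodule contains a joint eigenvector of `k` and `S`. By separation it is a multiple
of one basis vector, and `hgen` reaches all the others from there. -/
theorem IsLadder.isSimpleModule [NeZero N] (hb : IsLadder D b lam σ) (hsep : Separated D N σ)
    (hgen : ∀ m n, ∃ (u : Uq D.q) (c : ℂ), c ≠ 0 ∧ u • b m = c • b n) :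
    IsSimpleModule (Uq D.q) V := by
  have : FiniteDimensional ℂ V := b.finiteDimensional_of_finite
  have : Nontrivial V := ⟨b 0, 0, b.ne_zero 0⟩
  rw [isSimpleModule_iff]
  refine ⟨fun M => or_iff_not_imp_left.2 fun hM => ?_⟩
  have : Nontrivial M := Submodule.nontrivial_iff_ne_bot.2 hM
  have : FiniteDimensional ℂ M :=
    inferInstanceAs (FiniteDimensional ℂ (M.restrictScalars ℂ))
  obtain ⟨⟨x, hxM⟩, κ, τ, hx0, hx⟩ := exists_isWeight D M
  have hx0' : x ≠ 0 := fun h => hx0 (Subtype.ext h)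
  have hk : Uq.gen D.q Gen.k • x = (κ : ℂ) • x := congrArg Subtype.val hx.k
  have hS : D.S • x = τ • x := congrArg Subtype.val hx.S
  have hcoord : ∀ n, b.repr x n ≠ 0 →
      (lam * (D.q ^ n.val)⁻¹ : ℂ) = κ ∧ σ * (-1) ^ n.val = τ := by
    intro n hn
    have h1 := repr_smul_of_diagonal b (fun i => (hb.weight i).k) x n
    have h2 := repr_smul_of_diagonal b (fun i => (hb.weight i).S) x n
    rw [hk, map_smul, Finsupp.smul_apply, smul_eq_mul] at h1
    rw [hS, map_smul, Finsupp.smul_apply, smul_eq_mul] at h2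
    exact ⟨(mul_right_cancel₀ hn h1).symm, (mul_right_cancel₀ hn h2).symm⟩
  obtain ⟨m, hm⟩ : ∃ m, b.repr x m ≠ 0 := by
    by_contra! h
    exact hx0' (b.repr.map_eq_zero_iff.1 (Finsupp.ext h))
  have hxm : x = b.repr x m • b m := by
    apply b.repr.injective
    ext n
    rw [map_smul, Finsupp.smul_apply, b.repr_self, smul_eq_mul]
    by_cases hmn : m = n
    · subst hmn; simp
    · rw [Finsupp.single_eq_of_ne (Ne.symm hmn), mul_zero]
      by_contra hn
      apply hmn
      obtain ⟨h1, h2⟩ := hcoord m hm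
      obtain ⟨h3, h4⟩ := hcoord n hn
      refine hsep m n ?_ (h2.trans h4.symm)
      exact inv_injective (mul_left_cancel₀ lam.ne_zero (h1.trans h3.symm))
  have hbm : b m ∈ M := by
    have h := M.smul_of_tower_mem (b.repr x m)⁻¹ hxM
    rw [hxm, smul_smul] at h
    simpa [hm] using h
  refine eq_top_of_basis_mem b M fun n => ?_
  obtain ⟨u, c, hc, hu⟩ := hgen m n
  have h := M.smul_of_tower_mem c⁻¹ (M.smul_mem u hbm)
  rwa [hu, smul_smul, inv_mul_cancel₀ hc, one_smul] at h

/-- A linear map between spaces of the same finite dimension whose image contains multiples of all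
basis vectors is bijective. -/
theorem nonempty_equiv_of_basis {q : ℂ} {ι V W : Type*} [Fintype ι] [AddCommGroup V] [Module ℂ V]
    [Module (Uq q) V] [AddCommGroup W] [Module ℂ W] [Module (Uq q) W] [IsScalarTower ℂ (Uq q) V]
    [IsScalarTower ℂ (Uq q) W] (b : Module.Basis ι ℂ V) (b' : Module.Basis ι ℂ W)
    (T : V →ₗ[Uq q] W) (h : ∀ i, ∃ (x : V) (c : ℂ), c ≠ 0 ∧ T x = c • b' i) :
    Nonempty (V ≃ₗ[Uq q] W) := by
  have : FiniteDimensional ℂ V := b.finiteDimensional_of_finite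
  have : FiniteDimensional ℂ W := b'.finiteDimensional_of_finite
  have hs : Function.Surjective (T.restrictScalars ℂ) := by
    rw [← LinearMap.range_eq_top, eq_top_iff, ← b'.span_eq, Submodule.span_le]
    rintro _ ⟨i, rfl⟩
    obtain ⟨x, c, hc, hx⟩ := h i
    refine ⟨c⁻¹ • x, ?_⟩
    have hx' : T.restrictScalars ℂ x = c • b' i := hx
    rw [map_smul, hx', smul_smul, inv_mul_cancel₀ hc, one_smul]
  have hd : Module.finrank ℂ V = Module.finrank ℂ W := by
    rw [Module.finrank_eq_card_basis b, Module.finrank_eq_card_basis b']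
  have hi := (LinearMap.injective_iff_surjective_of_finrank_eq_finrank hd).2 hs
  exact ⟨LinearEquiv.ofBijective T ⟨hi, hs⟩⟩

/-- Simplicity is not assumed, since the case `σ = 0`, `l` odd, `N = L` must be included;
bijectivity comes from the injectivity of `f` and a dimension count. The shift `j` expresses the
redundancy of the parameters: starting at `f ^ j • b 0` replaces `(λ, σ)` by `(λ q⁻ʲ, (-1)ʲ σ)`. -/
theorem IsLadder.nonempty_cycPlus_equiv [NeZero N] (hb : IsLadder D b lam σ) (hN : D.q ^ N = 1)
    {lam' φ : ℂˣ} {σ' : ℂ} (hσ' : σ' = 0 ∨ Even N)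
    (hf : ∀ v : V, Uq.gen D.q Gen.f ^ N • v = (φ : ℂ) ^ N • v) (j : ℕ)
    (hlam : (lam' : ℂ) = lam * (D.q ^ j)⁻¹) (hσσ : σ' = σ * (-1) ^ j) :
    Nonempty (AsModule (D.cycPlus N hN lam' φ σ' hσ') ≃ₗ[Uq D.q] V) := by
  have hw : IsWeight D (Uq.gen D.q Gen.f ^ j • b 0) (lam' : ℂ) σ' := by
    rw [hlam, hσσ]; exact hb.weight_zero.f_pow j
  obtain ⟨T, hT⟩ := exists_hom_cycPlus hN hσ' hw (hf _)
  have hf' : ∀ v : V, Uq.gen D.q Gen.f ^ N • v = ((φ ^ N : ℂˣ) : ℂ) • v := by simpa using hf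
  refine nonempty_equiv_of_basis (ketBasis _) b T fun m => ?_
  -- The image of `|n⟩` is a multiple of `f ^ (n + j) • b 0`, which lies on the line of `b m` for
  -- this `n`.
  obtain ⟨n, hn⟩ : ∃ n : ZMod N, n = m - j := ⟨_, rfl⟩
  obtain ⟨a, ha⟩ := hb.f_pow (n.val + j) 0
  refine ⟨ketBasis _ n, ((φ : ℂ)⁻¹) ^ n.val * a, ?_, ?_⟩
  · refine mul_ne_zero (pow_ne_zero _ (inv_ne_zero φ.ne_zero)) ?_
    rintro rfl
    rw [zero_smul] at ha
    exact pow_smul_ne_zero hf' _ (b.ne_zero 0) ha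
  · rw [hT, ← mul_smul (Uq.gen D.q Gen.f ^ n.val), ← pow_add, ha, smul_smul]
    congr 2
    simp [hn]

theorem IsLadder.nonempty_cycMinus_equiv [NeZero N] (hb : IsLadder D b lam σ) (hN : D.q ^ N = 1)
    {lam' ε : ℂˣ} {σ' : ℂ} (hσ' : σ' = 0 ∨ Even N)
    (he : ∀ v : V, Uq.gen D.q Gen.e ^ N • v = (ε : ℂ) ^ N • v) (j : ℕ)
    (hlam : (lam' : ℂ) = lam * D.q ^ j) (hσσ : σ' = σ * (-1) ^ j) :
    Nonempty (AsModule (D.cycMinus N hN lam' ε σ' hσ') ≃ₗ[Uq D.q] V) := by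
  have hw : IsWeight D (Uq.gen D.q Gen.e ^ j • b 0) (lam' : ℂ) σ' := by
    rw [hlam, hσσ]; exact hb.weight_zero.e_pow j
  obtain ⟨T, hT⟩ := exists_hom_cycMinus hN hσ' hw (he _)
  have he' : ∀ v : V, Uq.gen D.q Gen.e ^ N • v = ((ε ^ N : ℂˣ) : ℂ) • v := by simpa using he
  refine nonempty_equiv_of_basis (ketBasis _) b T fun m => ?_
  obtain ⟨n, hn⟩ : ∃ n : ZMod N, n = -m - j := ⟨_, rfl⟩
  obtain ⟨a, ha⟩ := hb.e_pow (n.val + j) 0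
  refine ⟨ketBasis _ (-n), ((ε : ℂ)⁻¹) ^ n.val * a, ?_, ?_⟩
  · refine mul_ne_zero (pow_ne_zero _ (inv_ne_zero ε.ne_zero)) ?_
    rintro rfl
    rw [zero_smul] at ha
    exact pow_smul_ne_zero he' _ (b.ne_zero 0) ha
  · rw [hT, neg_neg, ← mul_smul (Uq.gen D.q Gen.e ^ n.val), ← pow_add, ha, smul_smul]
    congr 2
    simp [hn]

/-- With `φ` an `N`-th root of `c`, both modules are isomorphic to the same periodic module with
parameters `(λ, φ, σ)`. -/
theorem IsLadder.nonempty_equiv_of_f_pow [NeZero N] {b' : Module.Basis (ZMod N) ℂ W} {lam' : ℂˣ}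
    {σ' : ℂ} (hb : IsLadder D b lam σ) (hb' : IsLadder D b' lam' σ') (hN : D.q ^ N = 1)
    (hσ : σ = 0 ∨ Even N) {c : ℂ} (hc : c ≠ 0)
    (hV : ∀ v : V, Uq.gen D.q Gen.f ^ N • v = c • v)
    (hW : ∀ w : W, Uq.gen D.q Gen.f ^ N • w = c • w) {j : ℕ}
    (hlam : (lam : ℂ) = lam' * (D.q ^ j)⁻¹) (hσσ : σ = σ' * (-1) ^ j) :
    Nonempty (V ≃ₗ[Uq D.q] W) := by
  obtain ⟨φ, rfl⟩ := IsAlgClosed.exists_pow_nat_eq c (Nat.pos_of_ne_zero (NeZero.ne N))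
  have hφ : φ ≠ 0 := ne_zero_pow (NeZero.ne N) hc
  lift φ to ℂˣ using isUnit_iff_ne_zero.2 hφ
  obtain ⟨T⟩ := hb.nonempty_cycPlus_equiv hN hσ hV 0 (by simp : (lam : ℂ) = _) (by simp)
  obtain ⟨T'⟩ := hb'.nonempty_cycPlus_equiv hN hσ hW j hlam hσσ
  exact ⟨T.symm.trans T'⟩

theorem IsLadder.nonempty_equiv_of_e_pow [NeZero N] {b' : Module.Basis (ZMod N) ℂ W} {lam' : ℂˣ}
    {σ' : ℂ} (hb : IsLadder D b lam σ) (hb' : IsLadder D b' lam' σ') (hN : D.q ^ N = 1)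
    (hσ' : σ' = 0 ∨ Even N) {c : ℂ} (hc : c ≠ 0)
    (hV : ∀ v : V, Uq.gen D.q Gen.e ^ N • v = c • v)
    (hW : ∀ w : W, Uq.gen D.q Gen.e ^ N • w = c • w) {j : ℕ}
    (hlam : (lam : ℂ) = lam' * (D.q ^ j)⁻¹) (hσσ : σ = σ' * (-1) ^ j) :
    Nonempty (V ≃ₗ[Uq D.q] W) := by
  obtain ⟨ε, rfl⟩ := IsAlgClosed.exists_pow_nat_eq c (Nat.pos_of_ne_zero (NeZero.ne N))
  have hε : ε ≠ 0 := ne_zero_pow (NeZero.ne N) hc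
  lift ε to ℂˣ using isUnit_iff_ne_zero.2 hε
  -- Powers of `e` multiply the weight by `q`, so here the shift by `j` is made in `V` and the
  -- common model carries the parameters of `W`.
  obtain ⟨T⟩ := hb.nonempty_cycMinus_equiv hN hσ' hV j (lam' := lam')
    (by rw [hlam, inv_mul_cancel_right₀ (pow_ne_zero _ D.q_ne_zero)])
    (by rw [hσσ, mul_assoc, ← mul_pow]; simp)
  obtain ⟨T'⟩ := hb'.nonempty_cycMinus_equiv hN hσ' hW 0 (by simp : (lam' : ℂ) = _) (by simp)
  exact ⟨T.symm.trans T'⟩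

end Ladder

/-! ### The modules of types `M_+` and `M_-` as ladders, and their simplicity. -/

section CyclicLadder

variable (D : RootDatum) {N : ℕ} [NeZero N] (hN : D.q ^ N = 1) (lam φ : ℂˣ) (σ : ℂ)
  (hσ : σ = 0 ∨ Even N)

theorem isLadder_cycPlus : IsLadder D (ketBasis (D.cycPlus N hN lam φ σ hσ)) lam σ where
  weight m := by
    have hq : D.q ^ m.val ≠ 0 := pow_ne_zero _ D.q_ne_zero
    have h := isWeight_of_f_smul_e (D := D) (lam := lam * (Units.mk0 _ hq)⁻¹) (σ := σ * (-1) ^ m.val)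
      (v := ketBasis (D.cycPlus N hN lam φ σ hσ) m) (by simp [D.cycPlus_k]) (by
        rw [D.cycPlus_e, smul_comm _ (_ : ℂ), D.cycPlus_f, sub_add_cancel, smul_smul]
        congr 1
        have hφ : (φ : ℂ) ≠ 0 := φ.ne_zero
        have hη := D.η_ne_zero
        simp [RootDatum.nilw]
        field_simp)
    simpa using h
  e m := ⟨_, D.cycPlus_e hN lam φ σ hσ m⟩
  f m := ⟨_, D.cycPlus_f hN lam φ σ hσ m⟩

theorem isLadder_cycMinus : IsLadder D (ketBasis (D.cycMinus N hN lam φ σ hσ)) lam σ where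
  weight m := by
    have hq : D.q ^ m.val ≠ 0 := pow_ne_zero _ D.q_ne_zero
    have h := isWeight_of_f_smul_e (D := D) (lam := lam * (Units.mk0 _ hq)⁻¹) (σ := σ * (-1) ^ m.val)
      (v := ketBasis (D.cycMinus N hN lam φ σ hσ) m) (by simp [D.cycMinus_k]) (by
        rw [D.cycMinus_e, smul_comm _ (_ : ℂ), D.cycMinus_f, sub_add_cancel, smul_smul]
        congr 1
        have hφ : (φ : ℂ) ≠ 0 := φ.ne_zero
        have hη := D.η_ne_zero
        simp [RootDatum.nilw]
        field_simp)
    simpa using h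
  e m := ⟨_, D.cycMinus_e hN lam φ σ hσ m⟩
  f m := ⟨_, D.cycMinus_f hN lam φ σ hσ m⟩

theorem cycPlus_f_pow (m : ZMod N) (n : ℕ) :
    Uq.gen D.q Gen.f ^ n • ketBasis (D.cycPlus N hN lam φ σ hσ) m =
      (φ : ℂ) ^ n • ketBasis (D.cycPlus N hN lam φ σ hσ) (m + n) := by
  induction n with
  | zero => simp
  | succ n ih =>
    rw [pow_succ', mul_smul, ih, smul_comm _ (_ : ℂ), D.cycPlus_f, smul_smul, pow_succ,
      Nat.cast_succ, add_assoc]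

theorem cycMinus_e_pow (m : ZMod N) (n : ℕ) :
    Uq.gen D.q Gen.e ^ n • ketBasis (D.cycMinus N hN lam φ σ hσ) m =
      (φ : ℂ) ^ n • ketBasis (D.cycMinus N hN lam φ σ hσ) (m - n) := by
  induction n with
  | zero => simp
  | succ n ih =>
    rw [pow_succ', mul_smul, ih, smul_comm _ (_ : ℂ), D.cycMinus_e, smul_smul, pow_succ,
      Nat.cast_succ, sub_sub]

theorem smul_eq_of_basis {q : ℂ} {ι V : Type*} [AddCommGroup V] [Module ℂ V] [Module (Uq q) V]
    [IsScalarTower ℂ (Uq q) V] (b : Module.Basis ι ℂ V) {u : Uq q} {c : ℂ}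
    (h : ∀ i, u • b i = c • b i) (v : V) : u • v = c • v := by
  have h1 : Algebra.lsmul ℂ ℂ V u = c • LinearMap.id := b.ext fun i => by simpa using h i
  exact LinearMap.congr_fun h1 v

theorem cycPlus_f_pow_smul (v : AsModule (D.cycPlus N hN lam φ σ hσ)) :
    Uq.gen D.q Gen.f ^ N • v = (φ : ℂ) ^ N • v :=
  smul_eq_of_basis (ketBasis _) (fun m => by simp [cycPlus_f_pow]) v

theorem cycMinus_e_pow_smul (v : AsModule (D.cycMinus N hN lam φ σ hσ)) :
    Uq.gen D.q Gen.e ^ N • v = (φ : ℂ) ^ N • v :=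
  smul_eq_of_basis (ketBasis _) (fun m => by simp [cycMinus_e_pow]) v

theorem isSimpleModule_cycPlus (hsep : Separated D N σ) :
    IsSimpleModule (Uq D.q) (AsModule (D.cycPlus N hN lam φ σ hσ)) :=
  (isLadder_cycPlus D hN lam φ σ hσ).isSimpleModule hsep fun m n =>
    ⟨Uq.gen D.q Gen.f ^ (n - m).val, (φ : ℂ) ^ (n - m).val, pow_ne_zero _ φ.ne_zero, by
      rw [cycPlus_f_pow]; simp⟩

theorem isSimpleModule_cycMinus (hsep : Separated D N σ) :
    IsSimpleModule (Uq D.q) (AsModule (D.cycMinus N hN lam φ σ hσ)) :=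
  (isLadder_cycMinus D hN lam φ σ hσ).isSimpleModule hsep fun m n =>
    ⟨Uq.gen D.q Gen.e ^ (m - n).val, (φ : ℂ) ^ (m - n).val, pow_ne_zero _ φ.ne_zero, by
      rw [cycMinus_e_pow]; simp⟩

end CyclicLadder

theorem separated_l (D : RootDatum) (σ : ℂ) : Separated D D.l σ := fun m n h _ =>
  ZMod.val_injective _ (D.isPrimitiveRoot.pow_inj m.val_lt n.val_lt h)

/-- For `l` even, `L = l` and the powers of `q` suffice. For `l` odd they give the index modulo `l`,
the sign in front of `σ ≠ 0` gives it modulo `2`, and the Chinese remainder theorem gives it modulo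
`L = 2l`. -/
theorem separated_L (D : RootDatum) {σ : ℂ} (hσ : ¬(Odd D.l ∧ σ = 0)) : Separated D D.L σ := by
  intro m n h h'
  apply ZMod.val_injective
  have hm := m.val_lt
  have hn := n.val_lt
  generalize m.val = i at *
  generalize n.val = j at *
  rcases Nat.even_or_odd D.l with he | ho
  · have hL : D.L = D.l := if_pos he
    rw [hL] at hm hn
    exact D.isPrimitiveRoot.pow_inj hm hn h
  · have hL : D.L = 2 * D.l := if_neg (Nat.not_even_iff_odd.2 ho)
    have hσ0 : σ ≠ 0 := fun h0 => hσ ⟨ho, h0⟩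
    have hpar : Even i ↔ Even j := by
      have h1 := mul_left_cancel₀ hσ0 h'
      rcases Nat.even_or_odd i with hi | hi <;> rcases Nat.even_or_odd j with hj | hj
      · simp [hi, hj]
      · rw [hi.neg_one_pow, hj.neg_one_pow] at h1; norm_num at h1
      · rw [hi.neg_one_pow, hj.neg_one_pow] at h1; norm_num at h1
      · simp [Nat.not_even_iff_odd.2 hi, Nat.not_even_iff_odd.2 hj]
    have hmod : i ≡ j [MOD D.l] := by
      have h1 := D.isPrimitiveRoot.pow_eq_one
      rw [pow_eq_pow_mod i h1, pow_eq_pow_mod j h1] at h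
      have hl := Nat.pos_of_ne_zero (NeZero.ne D.l)
      exact D.isPrimitiveRoot.pow_inj (Nat.mod_lt _ hl) (Nat.mod_lt _ hl) h
    have hmod2 : i ≡ j [MOD 2] := by
      rw [Nat.even_iff, Nat.even_iff] at hpar
      unfold Nat.ModEq; omega
    have hco : Nat.Coprime 2 D.l := (Nat.coprime_two_left).2 ho
    have := (Nat.modEq_and_modEq_iff_modEq_mul hco).1 ⟨hmod2, hmod⟩
    rw [hL] at hm hn
    exact Nat.ModEq.eq_of_lt_of_lt this hm hn

/-! ### Nilpotent modules -/

section Nilpotent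

namespace RootDatum

variable (D : RootDatum) {lam : ℂˣ}

/-- This factorisation identifies the quantisation condition at `n + 1` with the vanishing of `e f ^
(n + 1)` on a highest weight vector, provided `f ^ n` does not kill it. -/
theorem nilw_succ (lam : ℂˣ) (n : ℕ) : D.nilw lam (D.nilσ lam) (n + 1) =
    -(D.s⁻¹ * (lam : ℂ)⁻¹ * (D.q ^ n)⁻¹) *
      ((D.q' ^ (n + 1) - 1) * ((lam : ℂ) ^ 2 - D.q' ^ n)) := by
  have hs := D.s_ne_zero
  have hl : (lam : ℂ) ≠ 0 := lam.ne_zero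
  have hx : D.q ^ n ≠ 0 := pow_ne_zero _ D.q_ne_zero
  unfold nilw nilσ q'
  rw [neg_pow D.q (n + 1), neg_pow D.q n]
  have hu : ((-1 : ℂ) ^ n) * (-1) ^ n = 1 := by rw [← mul_pow]; norm_num
  simp only [pow_succ]
  generalize (-1 : ℂ) ^ n = u at hu ⊢
  generalize D.q ^ n = x at hx ⊢
  rw [← D.s_sq] at *
  field_simp
  linear_combination (x ^ 2 * D.s ^ 2) * hu

theorem nilw_succ_eq_zero_iff (lam : ℂˣ) (n : ℕ) :
    D.nilw lam (D.nilσ lam) (n + 1) = 0 ↔ D.Quantised (n + 1) lam := by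
  rw [nilw_succ, Quantised, Nat.add_sub_cancel, mul_eq_zero_iff_left]
  exact neg_ne_zero.2 (mul_ne_zero (mul_ne_zero (inv_ne_zero D.s_ne_zero)
    (inv_ne_zero lam.ne_zero)) (inv_ne_zero (pow_ne_zero _ D.q_ne_zero)))

theorem q'_ne_zero : D.q' ≠ 0 := neg_ne_zero.2 D.q_ne_zero

theorem irredCond_factor_eq_zero_iff (d n : ℕ) (lam : ℂˣ) :
    D.s * (D.q ^ d)⁻¹ * lam + D.q ^ d * D.s⁻¹ * (lam : ℂ)⁻¹ * (D.q' ^ n)⁻¹ = 0 ↔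
      (lam : ℂ) ^ 2 * D.q' ^ (n + 1) = D.q' ^ (2 * d) := by
  have hs := D.s_ne_zero
  have hl : (lam : ℂ) ≠ 0 := lam.ne_zero
  have hx : D.q ^ d ≠ 0 := pow_ne_zero _ D.q_ne_zero
  have hy : D.q' ^ n ≠ 0 := pow_ne_zero _ D.q'_ne_zero
  have h2 : D.q' ^ (2 * d) = (D.q ^ d) ^ 2 := by
    rw [q', pow_mul, neg_sq, ← pow_mul, ← pow_mul, mul_comm]
  have h3 : D.q' ^ (n + 1) = -(D.q' ^ n * D.s ^ 2) := by
    rw [pow_succ, D.s_sq, q', mul_neg]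
  rw [h2, h3]
  generalize D.q ^ d = x at *
  generalize D.q' ^ n = y at *
  constructor
  · intro h
    field_simp at h
    linear_combination -h
  · intro h
    field_simp
    linear_combination -h

/-- The product is the list of earlier quantisation conditions read backwards, under `n ↦ d - n`. If
`q' ^ d = 1`, the second factor at `n` vanishes exactly when `λ ^ 2 = q' ^ (d - n - 1)`. If `λ ^ 2 =
q' ^ (d - 1)`, it vanishes exactly when `q' ^ (d - n) = 1`. -/
theorem irredCond_iff {d : ℕ} (hd : 1 ≤ d) (h : D.Quantised d lam) :
    D.IrredCond d lam ↔ ∀ m, m + 1 < d → ¬D.Quantised (m + 1) lam := by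
  have hq' := D.q'_ne_zero
  have key : ∀ n, (D.q' ^ n - 1) *
      (D.s * (D.q ^ d)⁻¹ * lam + D.q ^ d * D.s⁻¹ * (lam : ℂ)⁻¹ * (D.q' ^ n)⁻¹) = 0 ↔
      D.q' ^ n = 1 ∨ (lam : ℂ) ^ 2 * D.q' ^ (n + 1) = D.q' ^ (2 * d) := by
    intro n
    rw [mul_eq_zero, irredCond_factor_eq_zero_iff, sub_eq_zero]
  have hquant : ∀ m, D.Quantised (m + 1) lam ↔ D.q' ^ (m + 1) = 1 ∨ (lam : ℂ) ^ 2 = D.q' ^ m := by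
    intro m
    rw [Quantised, mul_eq_zero, sub_eq_zero, sub_eq_zero, Nat.add_sub_cancel]
  obtain ⟨c, rfl⟩ : ∃ c, d = c + 1 := ⟨d - 1, by omega⟩
  rw [hquant] at h
  unfold IrredCond
  simp only [Finset.prod_ne_zero_iff, ne_eq, key, hquant, Finset.mem_Icc, not_or]
  have hcancel : ∀ i j, D.q' ^ (i + j) = D.q' ^ i → D.q' ^ j = 1 := by
    intro i j hij
    rw [pow_add] at hij
    exact mul_left_cancel₀ (pow_ne_zero i hq') (hij.trans (mul_one _).symm)
  constructor
  · intro H m hm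
    refine ⟨(H (m + 1) (by omega)).1, fun hlam => ?_⟩
    -- As `d = c + 1`, the index `c - m` is the reflection `d - (m + 1)`.
    obtain ⟨h1, h2⟩ := H (c - m) (by omega)
    rcases h with h | h
    · apply h2
      rw [hlam, ← pow_add, mul_comm, pow_mul, h, one_pow, ← h]
      congr 1; omega
    · apply h1
      apply hcancel m
      rw [← hlam, h]
      congr 1; omega
  · intro H n hn
    refine ⟨?_, fun hlam => ?_⟩
    · have := (H (n - 1) (by omega)).1
      rwa [show n - 1 + 1 = n by omega] at this
    · obtain ⟨h1, h2⟩ := H (c - n) (by omega)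
      rcases h with h | h
      · apply h2
        apply mul_right_cancel₀ (pow_ne_zero (n + 1) hq')
        rw [hlam, ← pow_add, mul_comm, pow_mul, h, one_pow, ← h]
        congr 1; omega
      · apply h1
        apply hcancel (c + n + 1)
        rw [show c + n + 1 = c + (n + 1) by ring, pow_add _ c (n + 1), ← h, hlam]
        congr 1; omega

/-- If `l = 2n` with `n` odd, then `q ^ n = -1` and `(-q) ^ n = 1`; otherwise the exponent `L` is
even. Thus the quantisation condition always holds at `l'`, which bounds `d`. -/
theorem q'_pow_l' : D.q' ^ D.l' = 1 := by
  have h1 := D.q_pow_L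
  unfold l'
  split_ifs with h
  · have hL : D.L = D.l := if_pos (by rw [Nat.even_iff]; omega)
    obtain ⟨n, hn⟩ : ∃ n, D.l = 2 * n := ⟨D.l / 2, by omega⟩
    rw [hL, hn, Nat.mul_div_cancel_left _ two_pos, q', neg_pow, D.q_pow_half hn,
      Odd.neg_one_pow (by rw [Nat.odd_iff]; omega)]
    norm_num
  · rw [q', D.even_L.neg_pow, h1]

theorem l'_pos : 0 < D.l' := by
  have := D.two_lt_l
  unfold l' L
  split_ifs <;> omega

end RootDatum

variable (D : RootDatum) {d : ℕ} {lam : ℂˣ} (h : D.Quantised d lam)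

theorem nil_f_pow (hd : 0 < d) {m : ℕ} (hm : m < d) :
    Uq.gen D.q Gen.f ^ m • ketBasis (D.nil d lam h) ⟨0, hd⟩ = ketBasis (D.nil d lam h) ⟨m, hm⟩ := by
  induction m with
  | zero => simp
  | succ m ih => rw [pow_succ', mul_smul, ih (by omega), D.nil_f h hm]

theorem nil_e_pow {m : ℕ} (hm : m < d) :
    Uq.gen D.q Gen.e ^ (m + 1) • ketBasis (D.nil d lam h) ⟨m, hm⟩ = 0 := by
  induction m with
  | zero => rw [zero_add, pow_one, D.nil_e_zero]
  | succ m ih =>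
    rw [pow_succ, mul_smul, D.nil_e_succ, smul_comm _ (_ : ℂ), ih, smul_zero]

theorem nil_e_pow_smul (v : AsModule (D.nil d lam h)) : Uq.gen D.q Gen.e ^ d • v = 0 := by
  rw [← zero_smul ℂ v]
  refine smul_eq_of_basis (ketBasis _) (fun m => ?_) v
  obtain ⟨m, hm⟩ := m
  obtain ⟨n, rfl⟩ : ∃ n, d = n + (m + 1) := ⟨d - (m + 1), by omega⟩
  rw [pow_add, mul_smul, nil_e_pow, smul_zero, zero_smul]

/-- As `e` is nilpotent, a nonzero submodule contains a nonzero vector killed by `e`. No coefficient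
of `e` vanishes inside the string, so that vector is a multiple of `|0⟩`, which generates. -/
theorem isSimpleModule_nil (hd : 1 ≤ d) (hw : ∀ m, m + 1 < d → ¬D.Quantised (m + 1) lam) :
    IsSimpleModule (Uq D.q) (AsModule (D.nil d lam h)) := by
  set b := ketBasis (D.nil d lam h) with hb
  have : FiniteDimensional ℂ (AsModule (D.nil d lam h)) := b.finiteDimensional_of_finite
  have : Nontrivial (AsModule (D.nil d lam h)) := ⟨b ⟨0, hd⟩, 0, b.ne_zero _⟩
  rw [isSimpleModule_iff]
  refine ⟨fun M => or_iff_not_imp_left.2 fun hM => ?_⟩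
  have : Nontrivial M := Submodule.nontrivial_iff_ne_bot.2 hM
  have : FiniteDimensional ℂ M :=
    inferInstanceAs (FiniteDimensional ℂ (M.restrictScalars ℂ))
  obtain ⟨⟨x, hxM⟩, κ, hx0, hxe, -⟩ := exists_highestWeight D M
    ⟨d, fun v => Subtype.ext (nil_e_pow_smul D h v.1)⟩
  have hx0' : x ≠ 0 := fun h => hx0 (Subtype.ext h)
  have he : Uq.gen D.q Gen.e • x = 0 := congrArg Subtype.val hxe
  have hcoord : ∀ m (hm : m + 1 < d), b.repr x ⟨m + 1, hm⟩ = 0 := by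
    intro m hm
    -- The coordinate of `e • x` at `m` is a multiple of the coordinate of `x` at `m + 1`.
    have h1 : (b.coord ⟨m, by omega⟩).comp (Algebra.lsmul ℂ ℂ _ (Uq.gen D.q Gen.e)) =
        (D.η⁻¹ * D.nilw lam (D.nilσ lam) (m + 1)) • b.coord ⟨m + 1, hm⟩ := by
      refine b.ext ?_
      rintro ⟨j, hj⟩
      rcases j with _ | j
      · simp [hb, D.nil_e_zero]
      · by_cases hjm : j = m
        · subst hjm
          simp [hb, D.nil_e_succ]
        · simp [hb, D.nil_e_succ, hjm]
    have h2 := LinearMap.congr_fun h1 x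
    have h3 : (D.η⁻¹ * D.nilw lam (D.nilσ lam) (m + 1)) * b.repr x ⟨m + 1, hm⟩ = 0 := by
      refine h2.symm.trans ?_
      simp [he]
    refine (mul_eq_zero.1 h3).resolve_left (mul_ne_zero (inv_ne_zero D.η_ne_zero) ?_)
    rw [ne_eq, D.nilw_succ_eq_zero_iff]
    exact hw m hm
  have hx : x = b.repr x ⟨0, hd⟩ • b ⟨0, hd⟩ := by
    apply b.repr.injective
    ext ⟨n, hn⟩
    rw [map_smul, Finsupp.smul_apply, b.repr_self, smul_eq_mul]
    rcases n with _ | n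
    · simp
    · rw [hcoord, Finsupp.single_eq_of_ne (by simp), mul_zero]
  have hc : b.repr x ⟨0, hd⟩ ≠ 0 := by
    intro h0
    rw [h0, zero_smul] at hx
    exact hx0' hx
  have hb0 : b ⟨0, hd⟩ ∈ M := by
    have h := M.smul_of_tower_mem (b.repr x ⟨0, hd⟩)⁻¹ hxM
    rw [hx, smul_smul] at h
    simpa [hc] using h
  refine eq_top_of_basis_mem b M ?_
  rintro ⟨m, hm⟩
  rw [hb, ← nil_f_pow D h hd hm]
  exact M.smul_mem _ hb0

end Nilpotent

/-! ### Classification of the simple modules -/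

section Simple

variable {D : RootDatum} {V : Type*} [AddCommGroup V] [Module ℂ V] [Module (Uq D.q) V]

theorem ne_zero_of_pow_L_smul_ne_zero (ho : Odd D.l) {u : Uq D.q} {c : ℂ} {v : V}
    (hL : u ^ D.L • v ≠ 0) (hc : ∀ v : V, u ^ D.l • v = c • v) : c ≠ 0 := by
  rintro rfl
  apply hL
  rw [show D.L = 2 * D.l from if_neg (Nat.not_even_iff_odd.2 ho), two_mul, pow_add, mul_smul, hc,
    zero_smul]

variable [IsScalarTower ℂ (Uq D.q) V]

/-- Schur's lemma for an element that commutes with the generators on `V` only; this is the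
situation of `f ^ l` and `e ^ l` when `S` acts as zero. -/
theorem exists_scalar_of_commute [FiniteDimensional ℂ V] [IsSimpleModule (Uq D.q) V] {u : Uq D.q}
    (he : ∀ v : V, u • Uq.gen D.q Gen.e • v = Uq.gen D.q Gen.e • u • v)
    (hf : ∀ v : V, u • Uq.gen D.q Gen.f • v = Uq.gen D.q Gen.f • u • v)
    (hk : ∀ v : V, u • Uq.gen D.q Gen.k • v = Uq.gen D.q Gen.k • u • v) :
    ∃ c : ℂ, ∀ v : V, u • v = c • v := by
  obtain ⟨c, hc⟩ := (IsSimpleModule.algebraMap_end_bijective_of_isAlgClosed (A := Uq D.q)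
    (V := V) ℂ).2 (homOfGens (Algebra.lsmul ℂ ℂ V u) he hf hk)
  exact ⟨c, fun v => (LinearMap.congr_fun hc v).symm⟩

theorem exists_scalar_of_mem_center [FiniteDimensional ℂ V] [IsSimpleModule (Uq D.q) V]
    {z : Uq D.q} (hz : z ∈ Subalgebra.center ℂ (Uq D.q)) : ∃ c : ℂ, ∀ v : V, z • v = c • v := by
  rw [Subalgebra.mem_center_iff] at hz
  apply exists_scalar_of_commute <;> intro v <;> rw [← mul_smul, ← mul_smul, hz]

theorem nonempty_equiv_of_apply_ne_zero {R M V : Type*} [Ring R] [AddCommGroup M] [AddCommGroup V]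
    [Module R M] [Module R V] [IsSimpleModule R M] [IsSimpleModule R V] (T : M →ₗ[R] V) {x : M}
    (hx : T x ≠ 0) : Nonempty (V ≃ₗ[R] M) := by
  have hT : T ≠ 0 := by rintro rfl; exact hx rfl
  exact ⟨(LinearEquiv.ofBijective T (LinearMap.bijective_of_ne_zero hT)).symm⟩

/-- `S` commutes or anticommutes with each generator, so its kernel is a submodule. -/
theorem S_smul_eq_zero_of_simple [IsSimpleModule (Uq D.q) V] {v : V} (hv : v ≠ 0)
    (hS : D.S • v = 0) (w : V) : D.S • w = 0 := by
  have key : ∀ u : Uq D.q, ∀ w : V, D.S • w = 0 → D.S • u • w = 0 := by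
    intro u
    induction u using Uq.induction with
    | algebraMap c => intro w hw; rw [algebraMap_smul, smul_comm, hw, smul_zero]
    | gen g =>
      have hk : ∀ w : V, D.S • w = 0 → D.S • Uq.gen D.q Gen.k • w = 0 := fun w hw => by
        rw [← mul_smul, ← D.commute_k_S.eq, mul_smul, hw, smul_zero]
      cases g with
      | e => intro w hw; rw [← mul_smul, D.S_mul_e, neg_smul, mul_smul, hw, smul_zero, neg_zero]
      | f => intro w hw; rw [← mul_smul, D.S_mul_f, neg_smul, mul_smul, hw, smul_zero, neg_zero]
      | k => exact hk
      | kInv =>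
        intro w hw
        have hc := Uq.kInv_mul_of_k_mul (c := 1) one_ne_zero (x := D.S)
          (by rw [one_smul]; exact D.commute_k_S)
        rw [inv_one, one_smul] at hc
        rw [← mul_smul, ← hc, mul_smul, hw, smul_zero]
    | add x y hx hy => intro w hw; rw [add_smul, smul_add, hx w hw, hy w hw, add_zero]
    | mul x y hx hy => intro w hw; rw [mul_smul]; exact hx _ (hy w hw)
  let M : Submodule (Uq D.q) V :=
    { carrier := {w | D.S • w = 0}
      add_mem' := fun {a b} ha hb => by
        change D.S • (a + b) = 0
        rw [smul_add, show D.S • a = 0 from ha, show D.S • b = 0 from hb, add_zero]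
      zero_mem' := smul_zero _
      smul_mem' := fun u w hw => key u w hw }
  have hM : M = ⊤ := (eq_bot_or_eq_top M).resolve_left fun h => by
    have h1 : v ∈ M := hS
    rw [h] at h1
    exact hv h1
  have : w ∈ M := hM ▸ Submodule.mem_top
  exact this

theorem exists_l (D : RootDatum) : ∃ n, D.l = n + 1 ∧ D.q ^ n = D.q⁻¹ := by
  obtain ⟨n, hn⟩ := Nat.exists_eq_succ_of_ne_zero (NeZero.ne D.l)
  refine ⟨n, hn, ?_⟩
  have h := D.isPrimitiveRoot.pow_eq_one
  rw [hn, pow_succ] at h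
  exact eq_inv_of_mul_eq_one_left h

/-- The sign of the `S` term was the only reason for an even exponent. When `S` acts as zero, `q ^ l
= 1` is enough. -/
theorem exists_scalar_f_pow_l [FiniteDimensional ℂ V] [IsSimpleModule (Uq D.q) V]
    (hS : ∀ v : V, D.S • v = 0) : ∃ c : ℂ, ∀ v : V, Uq.gen D.q Gen.f ^ D.l • v = c • v := by
  apply exists_scalar_of_commute <;> intro v
  · obtain ⟨n, hn, h2⟩ := exists_l D
    apply D.smul_cancel
    rw [← mul_smul (Uq.gen D.q Gen.e), ← smul_assoc D.η (Uq.gen D.q Gen.e * _), hn,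
      D.η_smul_e_mul_f_pow, inv_pow, h2, inv_inv, D.s_inv_mul_q, D.s_mul_q_inv, mul_smul,
      add_smul, smul_assoc _ D.S, hS, smul_zero, add_zero, pow_succ, mul_smul,
      ← mul_smul (Uq.gen D.q Gen.f), smul_comm D.η, ← smul_assoc D.η, D.η_smul_f_mul_e,
      sub_smul _ D.S, hS, sub_zero]
  · rw [← mul_smul, ← mul_smul, ← pow_succ, ← pow_succ']
  · rw [← mul_smul, ← mul_smul, D.k_mul_f_pow, inv_pow, D.isPrimitiveRoot.pow_eq_one, inv_one,
      one_smul]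

theorem exists_scalar_e_pow_l [FiniteDimensional ℂ V] [IsSimpleModule (Uq D.q) V]
    (hS : ∀ v : V, D.S • v = 0) : ∃ c : ℂ, ∀ v : V, Uq.gen D.q Gen.e ^ D.l • v = c • v := by
  apply exists_scalar_of_commute <;> intro v
  · rw [← mul_smul, ← mul_smul, ← pow_succ, ← pow_succ']
  · obtain ⟨n, hn, h2⟩ := exists_l D
    apply D.smul_cancel
    rw [← mul_smul (Uq.gen D.q Gen.f), ← smul_assoc D.η (Uq.gen D.q Gen.f * _), hn,
      D.η_smul_f_mul_e_pow, inv_pow, h2, inv_inv, D.s_inv_mul_q, D.s_mul_q_inv, mul_smul,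
      sub_smul _ (_ • D.S), smul_assoc _ D.S, hS, smul_zero, sub_zero, pow_succ, mul_smul,
      ← mul_smul (Uq.gen D.q Gen.e), smul_comm D.η, ← smul_assoc D.η, D.η_smul_e_mul_f,
      add_smul _ D.S, hS, add_zero]
  · rw [← mul_smul, ← mul_smul, D.k_mul_e_pow, D.isPrimitiveRoot.pow_eq_one, one_smul]

/-- A root `φ` of the scalar of `f ^ L`, or of `f ^ l` when `l` is odd and `σ = 0`, gives a nonzero
map from the module with parameters `(λ, φ, σ)`, and both sides are simple. -/
theorem isPeriodic_of_f_pow_ne_zero [FiniteDimensional ℂ V] [IsSimpleModule (Uq D.q) V] {v : V}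
    {lam : ℂˣ} {σ : ℂ} (hv : v ≠ 0) (hw : IsWeight D v lam σ)
    (hf : Uq.gen D.q Gen.f ^ D.L • v ≠ 0) :
    D.IsPeriodic V (fun σ => ¬(Odd D.l ∧ σ = 0)) ∨ D.IsReducedPeriodic V := by
  by_cases hσ : Odd D.l ∧ σ = 0
  · obtain ⟨ho, rfl⟩ := hσ
    obtain ⟨c, hc⟩ := exists_scalar_f_pow_l (S_smul_eq_zero_of_simple hv
      (by rw [hw.S, zero_smul]))
    have hc0 := ne_zero_of_pow_L_smul_ne_zero ho hf hc
    obtain ⟨φ, rfl⟩ := IsAlgClosed.exists_pow_nat_eq c (Nat.pos_of_ne_zero (NeZero.ne D.l))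
    lift φ to ℂˣ using isUnit_iff_ne_zero.2 (ne_zero_pow (NeZero.ne D.l) hc0)
    obtain ⟨T, hT⟩ := exists_hom_cycPlus D.isPrimitiveRoot.pow_eq_one (Or.inl rfl) hw (hc v)
    have := isSimpleModule_cycPlus D D.isPrimitiveRoot.pow_eq_one lam φ 0 (Or.inl rfl)
      (separated_l D 0)
    exact Or.inr ⟨ho, Or.inl ⟨lam, φ, nonempty_equiv_of_apply_ne_zero T
      (x := ketBasis _ 0) (by rw [hT]; simpa using hv)⟩⟩
  · obtain ⟨c, hc⟩ := exists_scalar_of_mem_center (V := V) D.f_pow_L_mem_center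
    have hc0 : c ≠ 0 := by rintro rfl; rw [hc, zero_smul] at hf; exact hf rfl
    obtain ⟨φ, rfl⟩ := IsAlgClosed.exists_pow_nat_eq c (Nat.pos_of_ne_zero (NeZero.ne D.L))
    lift φ to ℂˣ using isUnit_iff_ne_zero.2 (ne_zero_pow (NeZero.ne D.L) hc0)
    obtain ⟨T, hT⟩ := exists_hom_cycPlus D.q_pow_L (Or.inr D.even_L) hw (hc v)
    have := isSimpleModule_cycPlus D D.q_pow_L lam φ σ (Or.inr D.even_L) (separated_L D hσ)
    exact Or.inl (Or.inl ⟨lam, φ, σ, hσ, nonempty_equiv_of_apply_ne_zero T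
      (x := ketBasis _ 0) (by rw [hT]; simpa using hv)⟩)

theorem isPeriodic_of_e_pow_ne_zero [FiniteDimensional ℂ V] [IsSimpleModule (Uq D.q) V] {v : V}
    {lam : ℂˣ} {σ : ℂ} (hv : v ≠ 0) (hw : IsWeight D v lam σ)
    (he : Uq.gen D.q Gen.e ^ D.L • v ≠ 0) :
    D.IsPeriodic V (fun σ => ¬(Odd D.l ∧ σ = 0)) ∨ D.IsReducedPeriodic V := by
  by_cases hσ : Odd D.l ∧ σ = 0
  · obtain ⟨ho, rfl⟩ := hσ
    obtain ⟨c, hc⟩ := exists_scalar_e_pow_l (S_smul_eq_zero_of_simple hv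
      (by rw [hw.S, zero_smul]))
    have hc0 := ne_zero_of_pow_L_smul_ne_zero ho he hc
    obtain ⟨ε, rfl⟩ := IsAlgClosed.exists_pow_nat_eq c (Nat.pos_of_ne_zero (NeZero.ne D.l))
    lift ε to ℂˣ using isUnit_iff_ne_zero.2 (ne_zero_pow (NeZero.ne D.l) hc0)
    obtain ⟨T, hT⟩ := exists_hom_cycMinus D.isPrimitiveRoot.pow_eq_one (Or.inl rfl) hw (hc v)
    have := isSimpleModule_cycMinus D D.isPrimitiveRoot.pow_eq_one lam ε 0 (Or.inl rfl)
      (separated_l D 0)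
    exact Or.inr ⟨ho, Or.inr ⟨lam, ε, nonempty_equiv_of_apply_ne_zero T
      (x := ketBasis _ 0) (by rw [hT]; simpa using hv)⟩⟩
  · obtain ⟨c, hc⟩ := exists_scalar_of_mem_center (V := V) D.e_pow_L_mem_center
    have hc0 : c ≠ 0 := by rintro rfl; rw [hc, zero_smul] at he; exact he rfl
    obtain ⟨ε, rfl⟩ := IsAlgClosed.exists_pow_nat_eq c (Nat.pos_of_ne_zero (NeZero.ne D.L))
    lift ε to ℂˣ using isUnit_iff_ne_zero.2 (ne_zero_pow (NeZero.ne D.L) hc0)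
    obtain ⟨T, hT⟩ := exists_hom_cycMinus D.q_pow_L (Or.inr D.even_L) hw (hc v)
    have := isSimpleModule_cycMinus D D.q_pow_L lam ε σ (Or.inr D.even_L) (separated_L D hσ)
    exact Or.inl (Or.inr ⟨lam, ε, σ, hσ, nonempty_equiv_of_apply_ne_zero T
      (x := ketBasis _ 0) (by rw [hT]; simpa using hv)⟩)

theorem quantised_of_f_pow_succ_eq_zero {v : V} {lam : ℂˣ}
    (hk : Uq.gen D.q Gen.k • v = (lam : ℂ) • v) (he : Uq.gen D.q Gen.e • v = 0) {n : ℕ}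
    (hn : Uq.gen D.q Gen.f ^ n • v ≠ 0) :
    Uq.gen D.q Gen.e • Uq.gen D.q Gen.f ^ (n + 1) • v = 0 ↔ D.Quantised (n + 1) lam := by
  rw [(isWeight_of_highestWeight hk he).e_smul_f_pow, smul_eq_zero_iff_left hn,
    mul_eq_zero_iff_left (inv_ne_zero D.η_ne_zero), D.nilw_succ_eq_zero_iff]

/-- The dimension `c + 1` is the length of the `f`-string of a highest weight vector `v`. If the
quantisation condition held earlier, a later vector `u` of the string would be killed by `e` and
generate a nonzero proper submodule. -/
theorem isNilpotentType_of_pow_eq_zero [FiniteDimensional ℂ V] [IsSimpleModule (Uq D.q) V]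
    (hf : ∀ v : V, Uq.gen D.q Gen.f ^ D.L • v = 0) (he : ∀ v : V, Uq.gen D.q Gen.e ^ D.L • v = 0) :
    D.IsNilpotentType V := by
  classical
  have := IsSimpleModule.nontrivial (Uq D.q) V
  obtain ⟨v, lam, hv, hev, hkv⟩ := exists_highestWeight D V ⟨_, he⟩
  have hex : ∃ n, Uq.gen D.q Gen.f ^ n • v = 0 := ⟨_, hf v⟩
  obtain ⟨c, hc⟩ : ∃ n, Nat.find hex = n + 1 := by
    refine Nat.exists_eq_succ_of_ne_zero fun h => hv ?_
    have := Nat.find_spec hex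
    rwa [h, pow_zero, one_smul] at this
  have hzero : Uq.gen D.q Gen.f ^ (c + 1) • v = 0 := hc ▸ Nat.find_spec hex
  have hne : ∀ m ≤ c, Uq.gen D.q Gen.f ^ m • v ≠ 0 := fun m hm =>
    Nat.find_min hex (by omega)
  have hquant : D.Quantised (c + 1) lam :=
    (quantised_of_f_pow_succ_eq_zero hkv hev (hne c le_rfl)).1 (by rw [hzero, smul_zero])
  have hirr : ∀ m, m + 1 < c + 1 → ¬D.Quantised (m + 1) lam := by
    intro m hm hq
    have he' := (quantised_of_f_pow_succ_eq_zero hkv hev (hne m (by omega))).2 hq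
    set u := Uq.gen D.q Gen.f ^ (m + 1) • v with hu
    obtain ⟨n, hn⟩ : ∃ n, n + (m + 1) = c := ⟨c - (m + 1), by omega⟩
    have hku : Uq.gen D.q Gen.k • u =
        ((lam * (Units.mk0 D.q D.q_ne_zero)⁻¹ ^ (m + 1) : ℂˣ) : ℂ) • u := by
      rw [hu, k_smul_f_pow hkv]; simp
    have hn1 : Uq.gen D.q Gen.f ^ n • u ≠ 0 := by
      rw [hu, ← mul_smul, ← pow_add, hn]; exact hne c le_rfl
    have hn2 : Uq.gen D.q Gen.f ^ (n + 1) • u = 0 := by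
      rw [hu, ← mul_smul, ← pow_add, ← hzero]; congr 2; omega
    have hqu := (quantised_of_f_pow_succ_eq_zero hku he' hn1).1 (by rw [hn2, smul_zero])
    obtain ⟨T, hT⟩ := exists_hom_nil hqu hku he' hn2
    -- The image of `T` is spanned by vectors of the string strictly after `v`, which `f ^ c` kills,
    -- whereas it does not kill `v`.
    have hkill : ∀ x, Uq.gen D.q Gen.f ^ c • T x = 0 := by
      have h1 : (Algebra.lsmul ℂ ℂ V (Uq.gen D.q Gen.f ^ c)).comp (T.restrictScalars ℂ) = 0 := by
        refine (ketBasis _).ext fun i => ?_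
        simp only [LinearMap.comp_apply, LinearMap.restrictScalars_apply, hT, LinearMap.zero_apply,
          Algebra.lsmul_coe]
        rw [← mul_smul, ← pow_add, ← hn, show n + (m + 1) + (i : ℕ) = (m + i) + (n + 1) by ring,
          pow_add, mul_smul, hn2, smul_zero]
      exact fun x => LinearMap.congr_fun h1 x
    have hrange : LinearMap.range T = ⊤ := (eq_bot_or_eq_top _).resolve_left fun h0 => by
      have h1 : T (ketBasis _ ⟨n, n.lt_succ_self⟩) ∈ LinearMap.range T := LinearMap.mem_range_self _ _
      rw [h0, Submodule.mem_bot, hT] at h1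
      exact hn1 h1
    obtain ⟨x, hx⟩ := LinearMap.range_eq_top.1 hrange v
    exact hne c le_rfl (hx ▸ hkill x)
  have hsimple := isSimpleModule_nil D hquant (by omega) hirr
  obtain ⟨T, hT⟩ := exists_hom_nil hquant hkv hev hzero
  have hIrr := (D.irredCond_iff (by omega) hquant).2 hirr
  refine ⟨c + 1, lam, hquant, by omega, ?_, hIrr, nonempty_equiv_of_apply_ne_zero T
    (x := ketBasis _ ⟨0, by omega⟩) (by rw [hT]; simpa using hv)⟩
  -- If `d > l'`, the quantisation condition at `l'`, which always holds, is an earlier one.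
  by_contra! hlt
  have hl' := D.l'_pos
  refine hirr (D.l' - 1) (by omega) ?_
  rw [show D.l' - 1 + 1 = D.l' by omega, RootDatum.Quantised, D.q'_pow_l', sub_self, zero_mul]

theorem isSimpleModule_iff_classified [FiniteDimensional ℂ V] :
    IsSimpleModule (Uq D.q) V ↔ D.IsPeriodic V (fun σ => ¬(Odd D.l ∧ σ = 0)) ∨
      D.IsReducedPeriodic V ∨ D.IsNilpotentType V := by
  constructor
  · intro _
    have := IsSimpleModule.nontrivial (Uq D.q) V
    obtain ⟨v, lam, σ, hv, hw⟩ := exists_isWeight D V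
    obtain ⟨a, ha⟩ := exists_scalar_of_mem_center (V := V) D.f_pow_L_mem_center
    obtain ⟨b, hb⟩ := exists_scalar_of_mem_center (V := V) D.e_pow_L_mem_center
    rw [← or_assoc]
    rcases eq_or_ne a 0 with rfl | ha0
    · rcases eq_or_ne b 0 with rfl | hb0
      · exact Or.inr (isNilpotentType_of_pow_eq_zero (fun v => by rw [ha, zero_smul])
          (fun v => by rw [hb, zero_smul]))
      · exact Or.inl (isPeriodic_of_e_pow_ne_zero hv hw (by rw [hb]; exact smul_ne_zero hb0 hv))
    · exact Or.inl (isPeriodic_of_f_pow_ne_zero hv hw (by rw [ha]; exact smul_ne_zero ha0 hv))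
  · rintro ((⟨lam, φ, σ, hσ, ⟨T⟩⟩ | ⟨lam, ε, σ, hσ, ⟨T⟩⟩) |
      ⟨_, ⟨lam, φ, ⟨T⟩⟩ | ⟨lam, ε, ⟨T⟩⟩⟩ | ⟨d, lam, h, hd, _, hirr, ⟨T⟩⟩)
    · have := isSimpleModule_cycPlus D D.q_pow_L lam φ σ (Or.inr D.even_L) (separated_L D hσ)
      exact IsSimpleModule.congr T
    · have := isSimpleModule_cycMinus D D.q_pow_L lam ε σ (Or.inr D.even_L) (separated_L D hσ)
      exact IsSimpleModule.congr T
    · have := isSimpleModule_cycPlus D D.isPrimitiveRoot.pow_eq_one lam φ 0 (Or.inl rfl)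
        (separated_l D 0)
      exact IsSimpleModule.congr T
    · have := isSimpleModule_cycMinus D D.isPrimitiveRoot.pow_eq_one lam ε 0 (Or.inl rfl)
        (separated_l D 0)
      exact IsSimpleModule.congr T
    · have := isSimpleModule_nil D h hd ((D.irredCond_iff hd h).1 hirr)
      exact IsSimpleModule.congr T

end Simple

/-! ### The centre acts by scalars on the modules of dimension `L` -/

section Continuity

variable {q : ℂ} {ι : Type*} [Fintype ι]

theorem apply_eq_sum_ket (A : Module.End ℂ (ι →₀ ℂ)) (x : ι →₀ ℂ) (n : ι) :
    A x n = ∑ j, x j * A (ket j) n := by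
  have hx : x = ∑ j, x j • ket j := by
    conv_lhs => rw [← Finsupp.univ_sum_single x]
    exact Finset.sum_congr rfl fun j _ => by simp [ket]
  conv_lhs => rw [hx]
  simp [Finsupp.finsetSum_apply]

/-- Matrix entries of any element arise from those of the generators by finite sums and products. -/
theorem continuous_rep_apply (ρ : ℂ → Uq q →ₐ[ℂ] Module.End ℂ (ι →₀ ℂ))
    (hρ : ∀ g m, ∃ (c : ℂ → ℂ) (j : ι), Continuous c ∧
      ∀ σ, Uq.gen q g • ketBasis (ρ σ) m = c σ • ketBasis (ρ σ) j)
    (u : Uq q) (m n : ι) : Continuous fun σ => (ρ σ u (ket m) : ι →₀ ℂ) n := by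
  induction u using Uq.induction generalizing m n with
  | algebraMap c =>
    simp only [AlgHom.commutes, Module.algebraMap_end_apply]
    exact continuous_const
  | gen g =>
    obtain ⟨c, j, hc, h⟩ := hρ g m
    have h' : ∀ σ, (ρ σ (Uq.gen q g) (ket m) : ι →₀ ℂ) = c σ • ket j := fun σ => by
      have := h σ
      rwa [ketBasis_apply, ketBasis_apply] at this
    simp only [h', Finsupp.smul_apply, smul_eq_mul]
    exact hc.mul continuous_const
  | add x y hx hy =>
    simp only [map_add, LinearMap.add_apply, Finsupp.add_apply]
    exact (hx m n).add (hy m n)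
  | mul x y hx hy =>
    simp only [map_mul, Module.End.mul_apply]
    have h : ∀ σ, (ρ σ x (ρ σ y (ket m)) : ι →₀ ℂ) n =
        ∑ j, (ρ σ y (ket m) : ι →₀ ℂ) j * (ρ σ x (ket j) : ι →₀ ℂ) n :=
      fun σ => apply_eq_sum_ket _ _ _
    simp only [h]
    exact continuous_finsetSum _ fun j _ => (hy m j).mul (hx j n)

/-- In a continuous family of representations, an element that acts by scalars off `0` acts by
scalars everywhere. -/
theorem exists_scalar_of_continuous [Nonempty ι] (ρ : ℂ → Uq q →ₐ[ℂ] Module.End ℂ (ι →₀ ℂ))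
    (hρ : ∀ g m, ∃ (c : ℂ → ℂ) (j : ι), Continuous c ∧
      ∀ σ, Uq.gen q g • ketBasis (ρ σ) m = c σ • ketBasis (ρ σ) j)
    (u : Uq q) (hu : ∀ σ ≠ 0, ∃ c : ℂ, ∀ v : AsModule (ρ σ), u • v = c • v) (σ : ℂ) :
    ∃ c : ℂ, ∀ v : AsModule (ρ σ), u • v = c • v := by
  obtain ⟨i⟩ := ‹Nonempty ι›
  -- Being scalar means that the entry at `(m, n)` is the fixed diagonal entry at `i` times the
  -- Kronecker delta. Both sides are continuous and agree on the dense set `σ ≠ 0`.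
  have key : ∀ m n, (fun σ => (ρ σ u (ket m) : ι →₀ ℂ) n) =
      fun σ => (ρ σ u (ket i) : ι →₀ ℂ) i * (ket m : ι →₀ ℂ) n := by
    intro m n
    refine Continuous.ext_on (dense_compl_singleton (0 : ℂ)) (continuous_rep_apply ρ hρ u m n)
      ((continuous_rep_apply ρ hρ u i i).mul continuous_const) fun τ hτ => ?_
    obtain ⟨c, hc⟩ := hu τ hτ
    have h : ∀ v : ι →₀ ℂ, ρ τ u v = c • v := hc
    simp only [h, Finsupp.smul_apply, smul_eq_mul]
    simp [ket]
  refine ⟨(ρ σ u (ket i) : ι →₀ ℂ) i, smul_eq_of_basis (ketBasis (ρ σ)) fun m => ?_⟩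
  apply smul_ketBasis
  ext n
  exact congrFun (key m n) σ

end Continuity

section Centre

variable (D : RootDatum)

theorem continuous_nilw (lam : ℂˣ) (m : ℕ) : Continuous fun σ => D.nilw lam σ m := by
  unfold RootDatum.nilw
  fun_prop

/-- Off `σ = 0` the module is simple and Schur's lemma applies; continuity covers `σ = 0`. -/
theorem MPlus_exists_scalar (lam φ : ℂˣ) (σ : ℂ) {z : Uq D.q}
    (hz : z ∈ Subalgebra.center ℂ (Uq D.q)) :
    ∃ c : ℂ, ∀ v : D.MPlus lam φ σ, z • v = c • v := by
  refine exists_scalar_of_continuous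
    (fun σ => D.cycPlus D.L D.q_pow_L lam φ σ (Or.inr D.even_L)) ?_ z ?_ σ
  · intro g m
    cases g with
    | e => exact ⟨_, m - 1, continuous_const.mul (continuous_nilw D lam m.val),
        fun σ => D.cycPlus_e _ lam φ σ _ m⟩
    | f => exact ⟨_, m + 1, continuous_const, fun σ => D.cycPlus_f _ lam φ σ _ m⟩
    | k => exact ⟨_, m, continuous_const, fun σ => D.cycPlus_k _ lam φ σ _ m⟩
    | kInv => exact ⟨_, m, continuous_const, fun σ => kInv_smul (D.cycPlus_k _ lam φ σ _ m)⟩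
  · intro τ hτ
    have := isSimpleModule_cycPlus D D.q_pow_L lam φ τ (Or.inr D.even_L)
      (separated_L D fun h => hτ h.2)
    have := (ketBasis (D.cycPlus D.L D.q_pow_L lam φ τ
      (Or.inr D.even_L))).finiteDimensional_of_finite
    exact exists_scalar_of_mem_center hz

theorem MMinus_exists_scalar (lam ε : ℂˣ) (σ : ℂ) {z : Uq D.q}
    (hz : z ∈ Subalgebra.center ℂ (Uq D.q)) :
    ∃ c : ℂ, ∀ v : D.MMinus lam ε σ, z • v = c • v := by
  refine exists_scalar_of_continuous
    (fun σ => D.cycMinus D.L D.q_pow_L lam ε σ (Or.inr D.even_L)) ?_ z ?_ σ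
  · intro g m
    cases g with
    | e => exact ⟨_, m - 1, continuous_const, fun σ => D.cycMinus_e _ lam ε σ _ m⟩
    | f => exact ⟨_, m + 1, continuous_const.mul (continuous_nilw D lam (m + 1).val),
        fun σ => D.cycMinus_f _ lam ε σ _ m⟩
    | k => exact ⟨_, m, continuous_const, fun σ => D.cycMinus_k _ lam ε σ _ m⟩
    | kInv => exact ⟨_, m, continuous_const, fun σ => kInv_smul (D.cycMinus_k _ lam ε σ _ m)⟩
  · intro τ hτ
    have := isSimpleModule_cycMinus D D.q_pow_L lam ε τ (Or.inr D.even_L)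
      (separated_L D fun h => hτ h.2)
    have := (ketBasis (D.cycMinus D.L D.q_pow_L lam ε τ
      (Or.inr D.even_L))).finiteDimensional_of_finite
    exact exists_scalar_of_mem_center hz

end Centre

/-! ### Comparison of scalars -/

section Scalars

variable {q : ℂ} {V W : Type*} [AddCommGroup V] [AddCommGroup W] [Module ℂ V] [Module ℂ W]
  [Module (Uq q) V] [Module (Uq q) W] {u : Uq q}

theorem SameScalar.right (h : SameScalar V W u) {v : V} {a : ℂ} (hv : v ≠ 0) (ha : u • v = a • v)
    (w : W) : u • w = a • w := by
  obtain ⟨c, hV, hW⟩ := h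
  rw [hW, smul_left_injective ℂ hv ((hV v).symm.trans ha)]

theorem SameScalar.eq (h : SameScalar V W u) {v : V} {w : W} {a a' : ℂ} (hv : v ≠ 0) (hw : w ≠ 0)
    (ha : u • v = a • v) (ha' : u • w = a' • w) : a = a' :=
  smul_left_injective ℂ hw ((h.right hv ha w).symm.trans ha')

variable [IsScalarTower ℂ (Uq q) V] [IsScalarTower ℂ (Uq q) W]

theorem map_complex_smul (T : V →ₗ[Uq q] W) (c : ℂ) (v : V) : T (c • v) = c • T v :=
  (T.restrictScalars ℂ).map_smul c v

theorem scalar_of_equiv (T : V ≃ₗ[Uq q] W) {c : ℂ} (h : ∀ v : V, u • v = c • v) (w : W) :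
    u • w = c • w := by
  obtain ⟨v, rfl⟩ := T.surjective w
  rw [← map_smul, h]
  exact map_complex_smul T.toLinearMap c v

theorem sameScalar_of_equiv (T : V ≃ₗ[Uq q] W) (h : ∃ c : ℂ, ∀ v : V, u • v = c • v) :
    SameScalar V W u :=
  let ⟨c, hc⟩ := h
  ⟨c, hc, scalar_of_equiv T hc⟩

end Scalars

/-! ### Ladders and scalars carried by the periodic modules. -/

section Data

variable {D : RootDatum} {V : Type*} [AddCommGroup V] [Module ℂ V] [Module (Uq D.q) V]
  [IsScalarTower ℂ (Uq D.q) V]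

theorem IsWeight.k_pow {v : V} {lam σ : ℂ} (h : IsWeight D v lam σ) (n : ℕ) :
    Uq.gen D.q Gen.k ^ n • v = lam ^ n • v := by
  induction n with
  | zero => simp
  | succ n ih => rw [pow_succ', mul_smul, ih, smul_comm _ (_ : ℂ), h.k, smul_smul, pow_succ]

/-- A ladder together with one nonzero period is all that the comparison uses, so the types `M_+`
and `M_-` need not be told apart. -/
theorem isPeriodic_exists_ladder {p : ℂ → Prop} (h : D.IsPeriodic V p) :
    ∃ (b : Module.Basis (ZMod D.L) ℂ V) (lam : ℂˣ) (σ : ℂ), p σ ∧ IsLadder D b lam σ ∧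
      ∃ c : ℂ, c ≠ 0 ∧ ((∀ v : V, Uq.gen D.q Gen.f ^ D.L • v = c • v) ∨
        ∀ v : V, Uq.gen D.q Gen.e ^ D.L • v = c • v) := by
  rcases h with ⟨lam, φ, σ, hσ, ⟨T⟩⟩ | ⟨lam, ε, σ, hσ, ⟨T⟩⟩
  · exact ⟨_, lam, σ, hσ, (isLadder_cycPlus D _ lam φ σ _).map T.symm, _,
      pow_ne_zero D.L φ.ne_zero,
      Or.inl (scalar_of_equiv T.symm (cycPlus_f_pow_smul D _ lam φ σ _))⟩
  · exact ⟨_, lam, σ, hσ, (isLadder_cycMinus D _ lam ε σ _).map T.symm, _,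
      pow_ne_zero D.L ε.ne_zero,
      Or.inr (scalar_of_equiv T.symm (cycMinus_e_pow_smul D _ lam ε σ _))⟩

theorem isPeriodic_exists_scalar {p : ℂ → Prop} (h : D.IsPeriodic V p) {z : Uq D.q}
    (hz : z ∈ Subalgebra.center ℂ (Uq D.q)) : ∃ c : ℂ, ∀ v : V, z • v = c • v := by
  rcases h with ⟨lam, φ, σ, _, ⟨T⟩⟩ | ⟨lam, ε, σ, _, ⟨T⟩⟩
  · exact (MPlus_exists_scalar D lam φ σ hz).imp fun c hc => scalar_of_equiv T.symm hc
  · exact (MMinus_exists_scalar D lam ε σ hz).imp fun c hc => scalar_of_equiv T.symm hc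

theorem isReducedPeriodic_exists_ladder (h : D.IsReducedPeriodic V) :
    ∃ (b : Module.Basis (ZMod D.l) ℂ V) (lam : ℂˣ), IsLadder D b lam 0 ∧
      ∃ c : ℂ, c ≠ 0 ∧ ((∀ v : V, Uq.gen D.q Gen.f ^ D.l • v = c • v) ∨
        ∀ v : V, Uq.gen D.q Gen.e ^ D.l • v = c • v) := by
  rcases h with ⟨_, ⟨lam, φ, ⟨T⟩⟩ | ⟨lam, ε, ⟨T⟩⟩⟩
  · exact ⟨_, lam, (isLadder_cycPlus D _ lam φ 0 _).map T.symm, _,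
      pow_ne_zero D.l φ.ne_zero,
      Or.inl (scalar_of_equiv T.symm (cycPlus_f_pow_smul D _ lam φ 0 _))⟩
  · exact ⟨_, lam, (isLadder_cycMinus D _ lam ε 0 _).map T.symm, _,
      pow_ne_zero D.l ε.ne_zero,
      Or.inr (scalar_of_equiv T.symm (cycMinus_e_pow_smul D _ lam ε 0 _))⟩

theorem IsLadder.S_smul_eq_zero {N : ℕ} {b : Module.Basis (ZMod N) ℂ V} {lam : ℂˣ}
    (hb : IsLadder D b lam 0) (v : V) : D.S • v = 0 := by
  rw [← zero_smul ℂ v]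
  exact smul_eq_of_basis b (fun i => by rw [(hb.weight i).S, zero_mul]) v

theorem isReducedPeriodic_finiteDimensional (h : D.IsReducedPeriodic V) :
    FiniteDimensional ℂ V := by
  obtain ⟨b, -⟩ := isReducedPeriodic_exists_ladder h
  exact b.finiteDimensional_of_finite

theorem isReducedPeriodic_isSimpleModule (h : D.IsReducedPeriodic V) :
    IsSimpleModule (Uq D.q) V := by
  have := isReducedPeriodic_finiteDimensional h
  exact isSimpleModule_iff_classified.2 (Or.inr (Or.inl h))

theorem isReducedPeriodic_exists_scalar (h : D.IsReducedPeriodic V) {z : Uq D.q}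
    (hz : z ∈ Subalgebra.center ℂ (Uq D.q)) : ∃ c : ℂ, ∀ v : V, z • v = c • v := by
  have := isReducedPeriodic_finiteDimensional h
  have := isReducedPeriodic_isSimpleModule h
  exact exists_scalar_of_mem_center hz

theorem isReducedPeriodic_exists_scalar_f (h : D.IsReducedPeriodic V) :
    ∃ c : ℂ, ∀ v : V, Uq.gen D.q Gen.f ^ D.l • v = c • v := by
  have := isReducedPeriodic_finiteDimensional h
  have := isReducedPeriodic_isSimpleModule h
  obtain ⟨b, lam, hb, -⟩ := isReducedPeriodic_exists_ladder h
  exact exists_scalar_f_pow_l hb.S_smul_eq_zero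

theorem isReducedPeriodic_exists_scalar_e (h : D.IsReducedPeriodic V) :
    ∃ c : ℂ, ∀ v : V, Uq.gen D.q Gen.e ^ D.l • v = c • v := by
  have := isReducedPeriodic_finiteDimensional h
  have := isReducedPeriodic_isSimpleModule h
  obtain ⟨b, lam, hb, -⟩ := isReducedPeriodic_exists_ladder h
  exact exists_scalar_e_pow_l hb.S_smul_eq_zero

end Data

/-! ### Twisting by parity -/

section Twist

variable (D : RootDatum) (W : Type*) [AddCommGroup W] [Module ℂ W] [Module (Uq D.q) W]
  [IsScalarTower ℂ (Uq D.q) W]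

/-- The twist of a module by the automorphism `e ↦ -e`, `f ↦ -f`, `k ↦ k`. -/
noncomputable def parityTwist : Uq D.q →ₐ[ℂ] Module.End ℂ W :=
  Uq.rep D.q (-Algebra.lsmul ℂ ℂ W (Uq.gen D.q Gen.e)) (-Algebra.lsmul ℂ ℂ W (Uq.gen D.q Gen.f))
    (Algebra.lsmul ℂ ℂ W (Uq.gen D.q Gen.k)) (Algebra.lsmul ℂ ℂ W (Uq.gen D.q Gen.kInv))
    (by rw [mul_neg, neg_mul, ← map_mul, Uq.k_mul_e, ← map_mul, smul_mul_assoc, mul_assoc,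
      Uq.k_mul_kInv, mul_one, map_smul, smul_neg])
    (by rw [mul_neg, neg_mul, ← map_mul, Uq.k_mul_f, ← map_mul, smul_mul_assoc, mul_assoc,
      Uq.k_mul_kInv, mul_one, map_smul, smul_neg])
    (by rw [neg_mul_neg, neg_mul_neg, ← map_mul, ← map_mul, ← map_add, Uq.e_mul_f, sub_add_cancel,
      map_smul, map_sub])
    (by rw [← map_mul, Uq.k_mul_kInv, map_one])
    (by rw [← map_mul, Uq.kInv_mul_k, map_one])

/-- The identity map from a module to its twist. -/
noncomputable def toTwist : W ≃ₗ[ℂ] AsModule (parityTwist D W) := LinearEquiv.refl ℂ W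

variable {D W}

theorem e_smul_toTwist (w : W) :
    Uq.gen D.q Gen.e • toTwist D W w = -toTwist D W (Uq.gen D.q Gen.e • w) := by
  rw [AsModule.smul_def, parityTwist, (Uq.rep_gen _ _ _ _ _ _ _ _ _ _).1]
  rfl

theorem f_smul_toTwist (w : W) :
    Uq.gen D.q Gen.f • toTwist D W w = -toTwist D W (Uq.gen D.q Gen.f • w) := by
  rw [AsModule.smul_def, parityTwist, (Uq.rep_gen _ _ _ _ _ _ _ _ _ _).2.1]
  rfl

theorem k_smul_toTwist (w : W) :
    Uq.gen D.q Gen.k • toTwist D W w = toTwist D W (Uq.gen D.q Gen.k • w) := by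
  rw [AsModule.smul_def, parityTwist, (Uq.rep_gen _ _ _ _ _ _ _ _ _ _).2.2.1]
  rfl

theorem kInv_smul_toTwist (w : W) :
    Uq.gen D.q Gen.kInv • toTwist D W w = toTwist D W (Uq.gen D.q Gen.kInv • w) := by
  rw [AsModule.smul_def, parityTwist, (Uq.rep_gen _ _ _ _ _ _ _ _ _ _).2.2.2]
  rfl

theorem S_smul_toTwist (w : W) : D.S • toTwist D W w = toTwist D W (D.S • w) := by
  unfold RootDatum.S
  simp only [sub_smul, smul_assoc, mul_smul, e_smul_toTwist, f_smul_toTwist, k_smul_toTwist,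
    kInv_smul_toTwist, smul_neg, map_sub, map_smul, neg_neg]

theorem f_pow_smul_toTwist (n : ℕ) (w : W) : Uq.gen D.q Gen.f ^ n • toTwist D W w =
    (-1 : ℂ) ^ n • toTwist D W (Uq.gen D.q Gen.f ^ n • w) := by
  induction n with
  | zero => simp
  | succ n ih =>
    rw [pow_succ', mul_smul, ih, smul_comm _ (_ : ℂ), f_smul_toTwist, pow_succ, mul_neg_one,
      neg_smul, smul_neg, mul_smul]

theorem e_pow_smul_toTwist (n : ℕ) (w : W) : Uq.gen D.q Gen.e ^ n • toTwist D W w =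
    (-1 : ℂ) ^ n • toTwist D W (Uq.gen D.q Gen.e ^ n • w) := by
  induction n with
  | zero => simp
  | succ n ih =>
    rw [pow_succ', mul_smul, ih, smul_comm _ (_ : ℂ), e_smul_toTwist, pow_succ, mul_neg_one,
      neg_smul, smul_neg, mul_smul]

theorem IsWeight.toTwist {w : W} {lam σ : ℂ} (h : IsWeight D w lam σ) :
    IsWeight D (toTwist D W w) lam σ where
  k := by rw [k_smul_toTwist, h.k, map_smul]
  S := by rw [S_smul_toTwist, h.S, map_smul]

theorem IsLadder.toTwist {N : ℕ} {b : Module.Basis (ZMod N) ℂ W} {lam : ℂˣ} {σ : ℂ}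
    (hb : IsLadder D b lam σ) : IsLadder D (b.map (toTwist D W)) lam σ where
  weight m := (hb.weight m).toTwist
  e m := by
    obtain ⟨a, ha⟩ := hb.e m
    exact ⟨-a, by simp only [Module.Basis.map_apply, e_smul_toTwist, ha, map_smul, neg_smul]⟩
  f m := by
    obtain ⟨a, ha⟩ := hb.f m
    exact ⟨-a, by simp only [Module.Basis.map_apply, f_smul_toTwist, ha, map_smul, neg_smul]⟩

theorem f_pow_l_toTwist (ho : Odd D.l) {c : ℂ} (h : ∀ w : W, Uq.gen D.q Gen.f ^ D.l • w = c • w)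
    (w : AsModule (parityTwist D W)) : Uq.gen D.q Gen.f ^ D.l • w = (-c) • w := by
  obtain ⟨w, rfl⟩ := (toTwist D W).surjective w
  rw [f_pow_smul_toTwist, h, map_smul, ho.neg_one_pow, neg_one_smul, neg_smul]

theorem e_pow_l_toTwist (ho : Odd D.l) {c : ℂ} (h : ∀ w : W, Uq.gen D.q Gen.e ^ D.l • w = c • w)
    (w : AsModule (parityTwist D W)) : Uq.gen D.q Gen.e ^ D.l • w = (-c) • w := by
  obtain ⟨w, rfl⟩ := (toTwist D W).surjective w
  rw [e_pow_smul_toTwist, h, map_smul, ho.neg_one_pow, neg_one_smul, neg_smul]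

variable {V : Type*} [AddCommGroup V] [Module ℂ V] [Module (Uq D.q) V]
  [IsScalarTower ℂ (Uq D.q) V]

theorem parityIsomorphic_iff : ParityIsomorphic (q := D.q) V W ↔
    Nonempty (V ≃ₗ[Uq D.q] AsModule (parityTwist D W)) := by
  constructor
  · rintro ⟨T, hT⟩
    let T' := T.trans (toTwist D W)
    refine ⟨LinearEquiv.ofBijective (homOfGens (q := D.q) T'.toLinearMap (fun v => ?_) (fun v => ?_)
      (fun v => ?_)) T'.bijective⟩
    · change toTwist D W (T _) = _ • toTwist D W (T v)
      rw [(hT v).1, e_smul_toTwist, map_neg]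
    · change toTwist D W (T _) = _ • toTwist D W (T v)
      rw [(hT v).2.1, f_smul_toTwist, map_neg]
    · change toTwist D W (T _) = _ • toTwist D W (T v)
      rw [(hT v).2.2, k_smul_toTwist]
  · rintro ⟨T⟩
    refine ⟨(T.restrictScalars ℂ).trans (toTwist D W).symm, fun v => ?_⟩
    have h : ∀ v, ((T.restrictScalars ℂ).trans (toTwist D W).symm) v = (toTwist D W).symm (T v) :=
      fun v => rfl
    obtain ⟨w, hw⟩ := (toTwist D W).surjective (T v)
    simp only [h, map_smul, ← hw, e_smul_toTwist, f_smul_toTwist, k_smul_toTwist, map_neg,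
      LinearEquiv.symm_apply_apply, and_self]

end Twist

/-! ### Comparison of the periodic modules -/

section Compare

variable {D : RootDatum} {V W : Type*} [AddCommGroup V] [AddCommGroup W] [Module ℂ V] [Module ℂ W]
  [Module (Uq D.q) V] [Module (Uq D.q) W] [IsScalarTower ℂ (Uq D.q) V] [IsScalarTower ℂ (Uq D.q) W]

theorem exists_eq_mul_q_pow {lam lam' : ℂˣ} (h : (lam : ℂ) ^ D.l = (lam' : ℂ) ^ D.l) :
    ∃ j : ℕ, (lam : ℂ) = lam' * (D.q ^ j)⁻¹ := by
  have h1 : ((lam' : ℂ) / lam) ^ D.l = 1 := by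
    rw [div_pow, h, div_self (pow_ne_zero _ lam'.ne_zero)]
  obtain ⟨j, _, hj⟩ := D.isPrimitiveRoot.eq_pow_of_pow_eq_one h1
  refine ⟨j, ?_⟩
  rw [hj, inv_div, mul_div_cancel₀ _ lam'.ne_zero]

theorem exists_eq_of_sameCentralAction {N N' : ℕ} {b : Module.Basis (ZMod N) ℂ V}
    {b' : Module.Basis (ZMod N') ℂ W} {lam lam' : ℂˣ} {σ σ' : ℂ} (hb : IsLadder D b lam σ)
    (hb' : IsLadder D b' lam' σ') (h : SameCentralAction (q := D.q) V W) :
    ∃ j : ℕ, (lam : ℂ) = lam' * (D.q ^ j)⁻¹ := by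
  apply exists_eq_mul_q_pow
  exact (h _ D.k_pow_l_mem_center).eq (b.ne_zero 0) (b'.ne_zero 0) (hb.weight_zero.k_pow D.l)
    (hb'.weight_zero.k_pow D.l)

theorem IsWeight.S_sq {v : V} {lam σ : ℂ} (h : IsWeight D v lam σ) :
    D.S ^ 2 • v = σ ^ 2 • v := by
  rw [sq, mul_smul, h.S, smul_comm _ σ, h.S, smul_smul, sq]

/-- The scalar of `k ^ l` gives `λ = λ' q⁻ʲ`. For `l = 2n` the scalar `λ ^ n σ` of `S k ^ n` then
fixes the sign of `σ`, as `q ^ n = -1`. For `l` odd, `S ^ 2` gives `σ = ±σ'`, and replacing `j` by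
`j + l` leaves `λ` alone while reversing the sign. -/
theorem exists_weight_eq_of_sameCentralAction {N N' : ℕ} {b : Module.Basis (ZMod N) ℂ V}
    {b' : Module.Basis (ZMod N') ℂ W} {lam lam' : ℂˣ} {σ σ' : ℂ} (hb : IsLadder D b lam σ)
    (hb' : IsLadder D b' lam' σ') (h : SameCentralAction (q := D.q) V W) :
    ∃ j : ℕ, (lam : ℂ) = lam' * (D.q ^ j)⁻¹ ∧ σ = σ' * (-1) ^ j := by
  obtain ⟨j, hj⟩ := exists_eq_of_sameCentralAction hb hb' h
  rcases Nat.even_or_odd D.l with he | ho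
  · refine ⟨j, hj, ?_⟩
    obtain ⟨n, hn⟩ := he
    rw [← two_mul] at hn
    have h1 : (D.S * Uq.gen D.q Gen.k ^ n) • b 0 = ((lam : ℂ) ^ n * σ) • b 0 := by
      rw [mul_smul, hb.weight_zero.k_pow, smul_comm _ (_ : ℂ), hb.weight_zero.S, smul_smul]
    have h2 : (D.S * Uq.gen D.q Gen.k ^ n) • b' 0 = ((lam' : ℂ) ^ n * σ') • b' 0 := by
      rw [mul_smul, hb'.weight_zero.k_pow, smul_comm _ (_ : ℂ), hb'.weight_zero.S, smul_smul]
    have h3 := (h _ (D.S_mul_k_pow_mem_center hn)).eq (b.ne_zero 0) (b'.ne_zero 0) h1 h2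
    rw [hj, mul_pow, inv_pow, ← pow_mul, mul_comm j, pow_mul, D.q_pow_half hn, ← inv_pow,
      inv_neg_one, mul_assoc] at h3
    have h4 := mul_left_cancel₀ (pow_ne_zero n lam'.ne_zero) h3
    rw [← h4, mul_comm, ← mul_assoc, ← mul_pow]
    simp
  · have h1 := (h _ D.S_sq_mem_center).eq (b.ne_zero 0) (b'.ne_zero 0) hb.weight_zero.S_sq
      hb'.weight_zero.S_sq
    have hq := D.isPrimitiveRoot.pow_eq_one
    have hj' : (lam : ℂ) = lam' * (D.q ^ (j + D.l))⁻¹ := by rw [pow_add, hq, mul_one, hj]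
    have hs : (-1 : ℂ) ^ (j + D.l) = -(-1) ^ j := by
      rw [pow_add, ho.neg_one_pow, mul_neg_one]
    rcases sq_eq_sq_iff_eq_or_eq_neg.1 h1 with rfl | rfl <;> rcases neg_one_pow_eq_or ℂ j with h | h
    · exact ⟨j, hj, by rw [h, mul_one]⟩
    · exact ⟨j + D.l, hj', by rw [hs, h, neg_neg, mul_one]⟩
    · exact ⟨j + D.l, hj', by rw [hs, h, mul_neg_one]⟩
    · exact ⟨j, hj, by rw [h, mul_neg_one]⟩

theorem isPeriodic_equiv_iff {p p' : ℂ → Prop} (hV : D.IsPeriodic V p) (hW : D.IsPeriodic W p') :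
    Nonempty (V ≃ₗ[Uq D.q] W) ↔ SameCentralAction (q := D.q) V W := by
  constructor
  · rintro ⟨T⟩ z hz
    exact sameScalar_of_equiv T (isPeriodic_exists_scalar hV hz)
  · intro h
    obtain ⟨b, lam, σ, -, hb, c, hc, hcV⟩ := isPeriodic_exists_ladder hV
    obtain ⟨b', lam', σ', -, hb', -⟩ := isPeriodic_exists_ladder hW
    obtain ⟨j, hj, hσ⟩ := exists_weight_eq_of_sameCentralAction hb hb' h
    rcases hcV with hf | he
    · exact hb.nonempty_equiv_of_f_pow hb' D.q_pow_L (Or.inr D.even_L) hc hf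
        ((h _ D.f_pow_L_mem_center).right (b.ne_zero 0) (hf _)) hj hσ
    · exact hb.nonempty_equiv_of_e_pow hb' D.q_pow_L (Or.inr D.even_L) hc he
        ((h _ D.e_pow_L_mem_center).right (b.ne_zero 0) (he _)) hj hσ

theorem isPeriodic_isReducedPeriodic_not_same (hV : D.IsPeriodic V (fun σ => σ ≠ 0))
    (hW : D.IsReducedPeriodic W) :
    IsEmpty (V ≃ₗ[Uq D.q] W) ∧ ¬SameCentralAction (q := D.q) V W := by
  have h2 : ¬SameCentralAction (q := D.q) V W := by
    intro h
    obtain ⟨b, lam, σ, hσ, hb, -⟩ := isPeriodic_exists_ladder hV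
    obtain ⟨b', lam', hb', -⟩ := isReducedPeriodic_exists_ladder hW
    -- `S ^ 2` acts by `σ ^ 2 ≠ 0` on one module and by `0` on the other.
    have h1 := (h _ D.S_sq_mem_center).eq (b.ne_zero 0) (b'.ne_zero 0) hb.weight_zero.S_sq
      hb'.weight_zero.S_sq
    rw [zero_pow two_ne_zero] at h1
    exact hσ (pow_eq_zero_iff two_ne_zero |>.1 h1)
  exact ⟨⟨fun T => h2 fun z hz => sameScalar_of_equiv T (isPeriodic_exists_scalar hV hz)⟩, h2⟩

theorem isReducedPeriodic_equiv_iff (hV : D.IsReducedPeriodic V) (hW : D.IsReducedPeriodic W) :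
    Nonempty (V ≃ₗ[Uq D.q] W) ↔ SameCentralAction (q := D.q) V W ∧
      SameScalar V W (Uq.gen D.q Gen.f ^ D.l) ∧ SameScalar V W (Uq.gen D.q Gen.e ^ D.l) := by
  constructor
  · rintro ⟨T⟩
    exact ⟨fun z hz => sameScalar_of_equiv T (isReducedPeriodic_exists_scalar hV hz),
      sameScalar_of_equiv T (isReducedPeriodic_exists_scalar_f hV),
      sameScalar_of_equiv T (isReducedPeriodic_exists_scalar_e hV)⟩
  · rintro ⟨h, hf', he'⟩
    obtain ⟨b, lam, hb, c, hc, hcV⟩ := isReducedPeriodic_exists_ladder hV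
    obtain ⟨b', lam', hb', -⟩ := isReducedPeriodic_exists_ladder hW
    obtain ⟨j, hj⟩ := exists_eq_of_sameCentralAction hb hb' h
    have hσ : (0 : ℂ) = 0 * (-1) ^ j := (zero_mul _).symm
    rcases hcV with hf | he
    · exact hb.nonempty_equiv_of_f_pow hb' D.isPrimitiveRoot.pow_eq_one (Or.inl rfl) hc hf
        (hf'.right (b.ne_zero 0) (hf _)) hj hσ
    · exact hb.nonempty_equiv_of_e_pow hb' D.isPrimitiveRoot.pow_eq_one (Or.inl rfl) hc he
        (he'.right (b.ne_zero 0) (he _)) hj hσ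

theorem pow_L_smul {D : RootDatum} {V : Type*} [AddCommGroup V] [Module ℂ V] [Module (Uq D.q) V]
    (ho : Odd D.l) {u : Uq D.q} {c : ℂ} (h : ∀ v : V, u ^ D.l • v = c • v) (v : V) :
    u ^ D.L • v = c ^ 2 • v := by
  rw [show D.L = 2 * D.l from if_neg (Nat.not_even_iff_odd.2 ho), two_mul, pow_add, mul_smul, h, h,
    smul_smul, sq]

/-- If `f ^ l` (or `e ^ l`) acts on `W` by `c`, it acts on the twist by `-c`, so its square acts by
`c ^ 2` on both. Hence one `L`-dimensional module with `σ = 0` maps onto a nonzero vector of each,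
and the centre acts on that module by scalars. -/
theorem exists_common_scalar {D : RootDatum} {W : Type*} [AddCommGroup W] [Module ℂ W]
    [Module (Uq D.q) W] [IsScalarTower ℂ (Uq D.q) W] (hW : D.IsReducedPeriodic W) {z : Uq D.q}
    (hz : z ∈ Subalgebra.center ℂ (Uq D.q)) :
    ∃ (w : W) (c : ℂ), w ≠ 0 ∧ z • w = c • w ∧ z • toTwist D W w = c • toTwist D W w := by
  obtain ⟨b, lam, hb, c, hc, hcW⟩ := isReducedPeriodic_exists_ladder hW
  obtain ⟨φ, hφ⟩ := IsAlgClosed.exists_pow_nat_eq (c ^ 2) (Nat.pos_of_ne_zero (NeZero.ne D.L))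
  have hφ0 : φ ≠ 0 := ne_zero_pow (NeZero.ne D.L) (hφ ▸ pow_ne_zero 2 hc)
  lift φ to ℂˣ using isUnit_iff_ne_zero.2 hφ0
  have hsig : (0 : ℂ) = 0 ∨ Even D.L := Or.inr D.even_L
  have hw := hb.weight_zero
  rcases hcW with hf | he
  · obtain ⟨a, ha⟩ := MPlus_exists_scalar D lam φ 0 hz
    refine ⟨b 0, a, b.ne_zero 0, ?_, ?_⟩
    · obtain ⟨T, hT⟩ := exists_hom_cycPlus D.q_pow_L hsig hw
        (by rw [hφ]; exact pow_L_smul hW.1 hf _)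
      have h0 : T (ketBasis _ 0) = b 0 := by rw [hT]; simp
      rw [← h0, ← map_smul, ha, map_complex_smul]
    · obtain ⟨T, hT⟩ := exists_hom_cycPlus D.q_pow_L hsig hw.toTwist
        (by rw [hφ, ← neg_sq]; exact pow_L_smul hW.1 (f_pow_l_toTwist hW.1 hf) _)
      have h0 : T (ketBasis _ 0) = toTwist D W (b 0) := by rw [hT]; simp
      rw [← h0, ← map_smul, ha, map_complex_smul]
  · obtain ⟨a, ha⟩ := MMinus_exists_scalar D lam φ 0 hz
    refine ⟨b 0, a, b.ne_zero 0, ?_, ?_⟩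
    · obtain ⟨T, hT⟩ := exists_hom_cycMinus D.q_pow_L hsig hw
        (by rw [hφ]; exact pow_L_smul hW.1 he _)
      have h0 : T (ketBasis _ 0) = b 0 := by rw [hT]; simp
      rw [← h0, ← map_smul, ha, map_complex_smul]
    · obtain ⟨T, hT⟩ := exists_hom_cycMinus D.q_pow_L hsig hw.toTwist
        (by rw [hφ, ← neg_sq]; exact pow_L_smul hW.1 (e_pow_l_toTwist hW.1 he) _)
      have h0 : T (ketBasis _ 0) = toTwist D W (b 0) := by rw [hT]; simp
      rw [← h0, ← map_smul, ha, map_complex_smul]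

theorem isReducedPeriodic_sameCentralAction_iff (hV : D.IsReducedPeriodic V)
    (hW : D.IsReducedPeriodic W) : SameCentralAction (q := D.q) V W ↔
      Nonempty (V ≃ₗ[Uq D.q] W) ∨ ParityIsomorphic (q := D.q) V W := by
  have ho := hV.1
  rw [parityIsomorphic_iff]
  constructor
  · intro h
    obtain ⟨b, lam, hb, c, hc, hcV⟩ := isReducedPeriodic_exists_ladder hV
    obtain ⟨b', lam', hb', -⟩ := isReducedPeriodic_exists_ladder hW
    obtain ⟨j, hj⟩ := exists_eq_of_sameCentralAction hb hb' h
    have hσ : (0 : ℂ) = 0 * (-1) ^ j := (zero_mul _).symm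
    have hN := D.isPrimitiveRoot.pow_eq_one
    rcases hcV with hf | he
    · obtain ⟨c', hc'⟩ := isReducedPeriodic_exists_scalar_f hW
      have h2 := (h _ D.f_pow_L_mem_center).eq (b.ne_zero 0) (b'.ne_zero 0) (pow_L_smul ho hf _)
        (pow_L_smul ho hc' _)
      -- The centre sees only the square of the scalar of `f ^ l`. Equal scalars give an isomorphism
      -- with `W`, opposite ones an isomorphism with its twist.
      rcases sq_eq_sq_iff_eq_or_eq_neg.1 h2 with rfl | rfl
      · exact Or.inl (hb.nonempty_equiv_of_f_pow hb' hN (Or.inl rfl) hc hf hc' hj hσ)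
      · exact Or.inr (hb.nonempty_equiv_of_f_pow hb'.toTwist hN (Or.inl rfl) hc hf
          (f_pow_l_toTwist ho hc') hj hσ)
    · obtain ⟨c', hc'⟩ := isReducedPeriodic_exists_scalar_e hW
      have h2 := (h _ D.e_pow_L_mem_center).eq (b.ne_zero 0) (b'.ne_zero 0) (pow_L_smul ho he _)
        (pow_L_smul ho hc' _)
      rcases sq_eq_sq_iff_eq_or_eq_neg.1 h2 with rfl | rfl
      · exact Or.inl (hb.nonempty_equiv_of_e_pow hb' hN (Or.inl rfl) hc he hc' hj hσ)
      · exact Or.inr (hb.nonempty_equiv_of_e_pow hb'.toTwist hN (Or.inl rfl) hc he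
          (e_pow_l_toTwist ho hc') hj hσ)
  · rintro (⟨⟨T⟩⟩ | ⟨⟨T⟩⟩) z hz
    · exact sameScalar_of_equiv T (isReducedPeriodic_exists_scalar hV hz)
    · obtain ⟨a, ha⟩ := isReducedPeriodic_exists_scalar hV hz
      obtain ⟨a', ha'⟩ := isReducedPeriodic_exists_scalar hW hz
      obtain ⟨w, c, hw0, hw, hw'⟩ := exists_common_scalar hW hz
      have h1 : a' = c := smul_left_injective ℂ hw0 ((ha' w).symm.trans hw)
      have h2 : a = c := smul_left_injective ℂ ((toTwist D W).map_ne_zero_iff.2 hw0)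
        ((scalar_of_equiv T ha _).symm.trans hw')
      exact ⟨c, fun v => by rw [ha, h2], fun w => by rw [ha', h1]⟩

end Compare

/-! ### Dimensions, and assembly of the theorem. -/

theorem finrank_asModule {q : ℂ} {ι : Type*} [Fintype ι]
    (ρ : Uq q →ₐ[ℂ] Module.End ℂ (ι →₀ ℂ)) :
    Module.finrank ℂ (AsModule ρ) = Fintype.card ι :=
  Module.finrank_eq_card_basis (ketBasis ρ)

end UqOsp

theorem mainTheorem2 (D : UqOsp.RootDatum) :
    -- the finite-dimensional irreducible representations are exactly the listed modules
    (∀ (V : Type*) [AddCommGroup V] [Module ℂ V] [Module (UqOsp.Uq D.q) V]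
        [IsScalarTower ℂ (UqOsp.Uq D.q) V] [FiniteDimensional ℂ V],
      IsSimpleModule (UqOsp.Uq D.q) V ↔
        D.IsPeriodic V (fun σ => ¬(Odd D.l ∧ σ = 0)) ∨ D.IsReducedPeriodic V ∨
          D.IsNilpotentType V) ∧
    -- the dimensions
    (∀ (lam φ : ℂˣ) (σ : ℂ), Module.finrank ℂ (D.MPlus lam φ σ) = D.L) ∧
    (∀ (lam ε : ℂˣ) (σ : ℂ), Module.finrank ℂ (D.MMinus lam ε σ) = D.L) ∧
    (∀ lam φ : ℂˣ, Module.finrank ℂ (D.MPlusRed lam φ) = D.l) ∧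
    (∀ lam ε : ℂˣ, Module.finrank ℂ (D.MMinusRed lam ε) = D.l) ∧
    (∀ (d : ℕ) (lam : ℂˣ) (h : D.Quantised d lam), Module.finrank ℂ (D.MNil d lam h) = d) ∧
    -- the isomorphisms among modules of types `M_+` and `M_-`
    (∀ (V W : Type*) [AddCommGroup V] [AddCommGroup W] [Module ℂ V] [Module ℂ W]
        [Module (UqOsp.Uq D.q) V] [Module (UqOsp.Uq D.q) W]
        [IsScalarTower ℂ (UqOsp.Uq D.q) V] [IsScalarTower ℂ (UqOsp.Uq D.q) W],
      (D.IsPeriodic V (fun _ => True) → D.IsPeriodic W (fun _ => True) →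
        (Nonempty (V ≃ₗ[UqOsp.Uq D.q] W) ↔ UqOsp.SameCentralAction (q := D.q) V W)) ∧
      (D.IsPeriodic V (fun σ => σ ≠ 0) → D.IsReducedPeriodic W →
        IsEmpty (V ≃ₗ[UqOsp.Uq D.q] W) ∧ ¬UqOsp.SameCentralAction (q := D.q) V W) ∧
      (D.IsReducedPeriodic V → D.IsReducedPeriodic W →
        (Nonempty (V ≃ₗ[UqOsp.Uq D.q] W) ↔
          UqOsp.SameCentralAction (q := D.q) V W ∧
          UqOsp.SameScalar V W (UqOsp.Uq.gen D.q UqOsp.Gen.f ^ D.l) ∧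
          UqOsp.SameScalar V W (UqOsp.Uq.gen D.q UqOsp.Gen.e ^ D.l)) ∧
        (UqOsp.SameCentralAction (q := D.q) V W ↔
          Nonempty (V ≃ₗ[UqOsp.Uq D.q] W) ∨ UqOsp.ParityIsomorphic (q := D.q) V W))) := by
  refine ⟨fun V _ _ _ _ _ => UqOsp.isSimpleModule_iff_classified, fun lam φ σ => ?_,
    fun lam ε σ => ?_, fun lam φ => ?_, fun lam ε => ?_, fun d lam h => ?_,
    fun V W _ _ _ _ _ _ _ _ => ⟨UqOsp.isPeriodic_equiv_iff,
      UqOsp.isPeriodic_isReducedPeriodic_not_same, fun hV hW =>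
        ⟨UqOsp.isReducedPeriodic_equiv_iff hV hW,
          UqOsp.isReducedPeriodic_sameCentralAction_iff hV hW⟩⟩⟩
  · rw [UqOsp.finrank_asModule, ZMod.card]
  · rw [UqOsp.finrank_asModule, ZMod.card]
  · rw [UqOsp.finrank_asModule, ZMod.card]
  · rw [UqOsp.finrank_asModule, ZMod.card]
  · rw [UqOsp.finrank_asModule, Fintype.card_fin]
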